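/- Let $K$ be a field, $n\ge 0$, and let $R=K[X_1,\dots,X_n]$ be the polynomial ring with its standard grading and homogeneous maximal ideal $R_+=(X_1,\dots,X_n)$. For an integer $m$ and a set of indices $\mathcal X\subseteq\mathbb N$, a finitely generated $\mathbb Z$-graded $R$-module $M$ is called $m$-regular with respect to $\mathcal X$ if $H^i_{R_+}(M)_e=0$ for all $i\in\mathcal X$ and all integers $e>m-i$; it is called $m$-regular if it is $m$-regular with respect to $\{0,\dots,n\}$. For $k\in\mathbb N$ put $\mathcal X+k=\{i+k : i\in\mathcal X\}$. Theorem 3.3. Let $M$ and $N$ be finitely generated $\mathbb Z$-graded $R$-modules, let $a\ge 0$ be an integer, let $\mathcal X=\{a,\dots,n\}$, and let $m,s$ be integers. Suppose that $M$ is $m$-regular, that $N$ is $s$-regular with respect to $\mathcal X$, and that, for all $i>0$, $\operatorname{Tor}_i^R(M,N)$ (with its natural grading) is $(m+s+i+1)$-regular with respect to $\mathcal X+i+1$. Then $M\otimes_R N$ is $(m+s)$-regular with respect to $\mathcal X$. -/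

import Mathlib

open scoped TensorProduct

universe u v w

namespace GradedReg

noncomputable section

/-- `ℳ` is a `ℤ`-grading of the module `M` over the standard graded polynomial ring
`R = K[X_1, …, X_n]`: `M = ⨁_d ℳ d` and `R_k ℳ_d ⊆ ℳ_{k+d}`. -/
structure IsGrading (K : Type u) [Field K] (n : ℕ) {M : Type v} [AddCommGroup M]
    [Module (MvPolynomial (Fin n) K) M] (ℳ : ℤ → AddSubgroup M) : Prop where
  isInternal : DirectSum.IsInternal ℳ
  smul_mem : ∀ (k : ℕ) (d : ℤ) (p : MvPolynomial (Fin n) K) (x : M),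
    p.IsHomogeneous k → x ∈ ℳ d → p • x ∈ ℳ (k + d)

/-- The subquotient `Z / B` of a module (for submodules `B ≤ Z`). -/
abbrev Subquotient (R : Type u) [CommRing R] (C : Type v) [AddCommGroup C] [Module R C]
    (Z B : Submodule R C) : Type v :=
  Z ⧸ B.submoduleOf Z

/-- The grading induced on `Z / B` by a grading of the ambient module: the part of degree `d`
consists of the classes of the elements of `Z` of degree `d`. -/
def subquotientGrading (R : Type u) [CommRing R] (C : Type v) [AddCommGroup C] [Module R C]
    (𝒞 : ℤ → AddSubgroup C) (Z B : Submodule R C) (d : ℤ) : AddSubgroup (Subquotient R C Z B) :=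
  ((𝒞 d).comap Z.subtype.toAddMonoidHom).map (B.submoduleOf Z).mkQ.toAddMonoidHom

/-! ### Graded local cohomology with support in `R_+ = (X_1, …, X_n)`, by the Čech complex -/

/-- The multiplicative set of monomials in the variables `X_i`, `i ∈ S`. Localizing at it is the
same as inverting the product of these variables. -/
def monomialsIn (K : Type u) [Field K] (n : ℕ) (S : Finset (Fin n)) :
    Submonoid (MvPolynomial (Fin n) K) :=
  Submonoid.closure (MvPolynomial.X '' (S : Set (Fin n)))

theorem monomialsIn_mono (K : Type u) [Field K] (n : ℕ) {S T : Finset (Fin n)} (h : S ⊆ T) :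
    monomialsIn K n S ≤ monomialsIn K n T :=
  Submonoid.closure_mono (Set.image_mono (Finset.coe_subset.mpr h))

/-- `M_{x_S}`, the localization of `M` that inverts the variables `X_i`, `i ∈ S`. -/
abbrev Loc (K : Type u) [Field K] (n : ℕ) (M : Type v) [AddCommGroup M]
    [Module (MvPolynomial (Fin n) K) M] (S : Finset (Fin n)) : Type (max u v) :=
  LocalizedModule (monomialsIn K n S) M

/-- The grading of `M_{x_S}`: degree `e` consists of the fractions `x / t` with `t` of degree `k`
and `x` of degree `e + k`. (These are already closed under addition.) -/
def locGrading (K : Type u) [Field K] (n : ℕ) {M : Type v} [AddCommGroup M]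
    [Module (MvPolynomial (Fin n) K) M] (ℳ : ℤ → AddSubgroup M) (S : Finset (Fin n)) (e : ℤ) :
    AddSubgroup (Loc K n M S) :=
  AddSubgroup.closure {z | ∃ (k : ℕ) (t : monomialsIn K n S) (x : M),
    (t : MvPolynomial (Fin n) K).IsHomogeneous k ∧ x ∈ ℳ (e + k) ∧ z = LocalizedModule.mk x t}

/-- The canonical map `M_{x_S} → M_{x_T}`, `S ⊆ T`. -/
def locMap (K : Type u) [Field K] (n : ℕ) (M : Type v) [AddCommGroup M]
    [Module (MvPolynomial (Fin n) K) M] {S T : Finset (Fin n)} (h : S ⊆ T) :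
    Loc K n M S →ₗ[MvPolynomial (Fin n) K] Loc K n M T :=
  IsLocalizedModule.liftOfLE (monomialsIn K n S) (monomialsIn K n T) (monomialsIn_mono K n h)
    (LocalizedModule.mkLinearMap (monomialsIn K n S) M)
    (LocalizedModule.mkLinearMap (monomialsIn K n T) M)

/-- The `p`-th module `⨁_{|S| = p} M_{x_S}` of the Čech complex of `M` on `X_1, …, X_n`. -/
abbrev Cech (K : Type u) [Field K] (n : ℕ) (M : Type v) [AddCommGroup M]
    [Module (MvPolynomial (Fin n) K) M] (p : ℕ) : Type (max u v) :=
  (S : {S : Finset (Fin n) // S.card = p}) → Loc K n M S.1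

/-- The Čech differential
`(d ψ)_T = ∑_{j ∈ T} (-1)^{#{i ∈ T | i < j}} ψ_{T \ {j}}`. -/
def cechD (K : Type u) [Field K] (n : ℕ) (M : Type v) [AddCommGroup M]
    [Module (MvPolynomial (Fin n) K) M] (p : ℕ) :
    Cech K n M p →ₗ[MvPolynomial (Fin n) K] Cech K n M (p + 1) :=
  LinearMap.pi fun T => ∑ j : {j // j ∈ T.1},
    ((-1 : MvPolynomial (Fin n) K) ^ (T.1.filter (fun i => i < j.1)).card) •
      (locMap K n M (Finset.erase_subset j.1 T.1) ∘ₗ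
        LinearMap.proj (R := MvPolynomial (Fin n) K)
          (φ := fun S : {S : Finset (Fin n) // S.card = p} => Loc K n M S.1)
          ⟨T.1.erase j.1, by rw [Finset.card_erase_of_mem j.2, T.2]; rfl⟩)

/-- The grading of the Čech modules. -/
def cechGrading (K : Type u) [Field K] (n : ℕ) {M : Type v} [AddCommGroup M]
    [Module (MvPolynomial (Fin n) K) M] (ℳ : ℤ → AddSubgroup M) (p : ℕ) (e : ℤ) :
    AddSubgroup (Cech K n M p) :=
  AddSubgroup.pi Set.univ fun S => locGrading K n ℳ S.1 e

/-- The Čech coboundaries. -/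
def cechB (K : Type u) [Field K] (n : ℕ) (M : Type v) [AddCommGroup M]
    [Module (MvPolynomial (Fin n) K) M] :
    (p : ℕ) → Submodule (MvPolynomial (Fin n) K) (Cech K n M p)
  | 0 => ⊥
  | p + 1 => LinearMap.range (cechD K n M p)

/-- The local cohomology module `H^i_{R_+}(M)`. -/
abbrev LocalCohomology (K : Type u) [Field K] (n : ℕ) (M : Type v) [AddCommGroup M]
    [Module (MvPolynomial (Fin n) K) M] (i : ℕ) : Type (max u v) :=
  Subquotient (MvPolynomial (Fin n) K) (Cech K n M i)
    (LinearMap.ker (cechD K n M i)) (cechB K n M i)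

/-- The graded piece `H^i_{R_+}(M)_e`. -/
def localCohomologyGrading (K : Type u) [Field K] (n : ℕ) {M : Type v} [AddCommGroup M]
    [Module (MvPolynomial (Fin n) K) M] (ℳ : ℤ → AddSubgroup M) (i : ℕ) (e : ℤ) :
    AddSubgroup (LocalCohomology K n M i) :=
  subquotientGrading (MvPolynomial (Fin n) K) (Cech K n M i) (cechGrading K n ℳ i)
    (LinearMap.ker (cechD K n M i)) (cechB K n M i) e

/-- The graded module `(M, ℳ)` over `K[X_1, …, X_n]` is `m`-regular with respect to `𝒳`:
`H^i_{R_+}(M)_{> m - i} = 0` for all `i ∈ 𝒳`. -/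
def IsRegularWrt (K : Type u) [Field K] (n : ℕ) {M : Type v} [AddCommGroup M]
    [Module (MvPolynomial (Fin n) K) M] (ℳ : ℤ → AddSubgroup M) (m : ℤ) (𝒳 : Set ℕ) : Prop :=
  ∀ i ∈ 𝒳, ∀ e : ℤ, m - (i : ℤ) < e → localCohomologyGrading K n ℳ i e = ⊥

/-! ### Graded tensor products and graded Tor -/

/-- The grading of `M ⊗_R N`: degree `e` is generated by the `x ⊗ y` with `x`, `y` homogeneous and
`deg x + deg y = e`. -/
def tensorGrading (K : Type u) [Field K] (n : ℕ) {M : Type v} [AddCommGroup M]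
    [Module (MvPolynomial (Fin n) K) M] {N : Type w} [AddCommGroup N]
    [Module (MvPolynomial (Fin n) K) N] (ℳ : ℤ → AddSubgroup M) (𝒩 : ℤ → AddSubgroup N) (e : ℤ) :
    AddSubgroup (M ⊗[MvPolynomial (Fin n) K] N) :=
  AddSubgroup.closure {z | ∃ (c d : ℤ) (x : M) (y : N),
    x ∈ ℳ c ∧ y ∈ 𝒩 d ∧ c + d = e ∧ z = x ⊗ₜ[MvPolynomial (Fin n) K] y}

/-- The grading of the free module `⨁_{b ∈ ι} R(-deg b)`, whose basis element `b` has degree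
`deg b`: an element has degree `e` if all monomials `s` of its `b`-th coordinate satisfy
`|s| + deg b = e`. -/
def freeGrading (K : Type u) [Field K] (n : ℕ) {ι : Type v} (deg : ι → ℤ) (e : ℤ) :
    AddSubgroup (ι →₀ MvPolynomial (Fin n) K) where
  carrier := {f | ∀ (b : ι) (s : Fin n →₀ ℕ), (f b).coeff s ≠ 0 → (s.degree : ℤ) + deg b = e}
  zero_mem' := by
    intro b s h
    simp at h
  add_mem' := by
    intro f g hf hg b s h
    by_cases h1 : (f b).coeff s = 0
    · refine hg b s fun h2 => h ?_
      simp [h1, h2]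
    · exact hf b s h1
  neg_mem' := by
    intro f hf b s h
    refine hf b s fun h2 => h ?_
    simp [h2]

/-- A step in the construction of a graded free resolution: a graded free module, given by its
basis `ι` and the degrees of the basis elements, together with its submodule of cycles, which the
next free module has to cover. -/
structure ResolutionStep (K : Type u) [Field K] (n : ℕ) : Type (max u (w + 1)) where
  ι : Type w
  deg : ι → ℤ
  cycles : Submodule (MvPolynomial (Fin n) K) (ι →₀ MvPolynomial (Fin n) K)

/-- The generators of the next free module: one for each homogeneous cycle `f` of each
degree `d`. -/
abbrev ResolutionStep.Gen {K : Type u} [Field K] {n : ℕ}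
    (s : ResolutionStep.{u, w} K n) : Type (max u w) :=
  {p : ℤ × (s.ι →₀ MvPolynomial (Fin n) K) // p.2 ∈ s.cycles ∧ p.2 ∈ freeGrading K n s.deg p.1}

/-- The map from the next free module, sending each generator to the homogeneous cycle that
it stands for. Its image is the submodule of cycles. -/
def ResolutionStep.boundary {K : Type u} [Field K] {n : ℕ} (s : ResolutionStep.{u, w} K n) :
    (s.Gen →₀ MvPolynomial (Fin n) K) →ₗ[MvPolynomial (Fin n) K]
      (s.ι →₀ MvPolynomial (Fin n) K) :=
  Finsupp.linearCombination (MvPolynomial (Fin n) K) fun p : s.Gen => p.1.2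

/-- The next step; a generator has the degree of the homogeneous cycle that it stands for. -/
def ResolutionStep.next {K : Type u} [Field K] {n : ℕ}
    (s : ResolutionStep.{u, max u w} K n) : ResolutionStep.{u, max u w} K n where
  ι := s.Gen
  deg p := p.1.1
  cycles := LinearMap.ker s.boundary

/-- The standard graded free resolution `⋯ → F_1 → F_0 → M → 0` of `(M, ℳ)`. The module `F_0` has
one generator of degree `d` for each `x ∈ ℳ d`, mapping to `x`, and `F_{k+1}` has one generator of
degree `d` for each homogeneous element of degree `d` in the kernel of the map from `F_k`. -/
def stdResolution (K : Type u) [Field K] (n : ℕ) {M : Type v} [AddCommGroup M]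
    [Module (MvPolynomial (Fin n) K) M] (ℳ : ℤ → AddSubgroup M) :
    ℕ → ResolutionStep.{u, max u v} K n
  | 0 =>
    { ι := ULift.{u} (Σ d : ℤ, ℳ d)
      deg := fun b => b.down.1
      cycles := LinearMap.ker (Finsupp.linearCombination (MvPolynomial (Fin n) K)
        fun b : ULift.{u} (Σ d : ℤ, ℳ d) => (b.down.2 : M)) }
  | k + 1 => (stdResolution K n ℳ k).next

/-- The free module `F_k` of the standard graded free resolution of `(M, ℳ)`. -/
abbrev StdFree (K : Type u) [Field K] (n : ℕ) {M : Type v} [AddCommGroup M]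
    [Module (MvPolynomial (Fin n) K) M] (ℳ : ℤ → AddSubgroup M) (k : ℕ) : Type (max u v) :=
  (stdResolution K n ℳ k).ι →₀ MvPolynomial (Fin n) K

/-- The differential `F_{k+1} → F_k`. -/
def stdD (K : Type u) [Field K] (n : ℕ) {M : Type v} [AddCommGroup M]
    [Module (MvPolynomial (Fin n) K) M] (ℳ : ℤ → AddSubgroup M) (k : ℕ) :
    StdFree K n ℳ (k + 1) →ₗ[MvPolynomial (Fin n) K]
      StdFree K n ℳ k :=
  (stdResolution K n ℳ k).boundary

/-- The `i`-cycles of the complex `F_• ⊗_R N`. -/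
def torZ (K : Type u) [Field K] (n : ℕ) {M : Type v} [AddCommGroup M]
    [Module (MvPolynomial (Fin n) K) M] (ℳ : ℤ → AddSubgroup M) (N : Type w) [AddCommGroup N]
    [Module (MvPolynomial (Fin n) K) N] :
    (i : ℕ) → Submodule (MvPolynomial (Fin n) K)
      (StdFree K n ℳ i ⊗[MvPolynomial (Fin n) K] N)
  | 0 => ⊤
  | i + 1 => LinearMap.ker (LinearMap.rTensor N (stdD K n ℳ i))

/-- The `i`-boundaries of the complex `F_• ⊗_R N`. -/
def torB (K : Type u) [Field K] (n : ℕ) {M : Type v} [AddCommGroup M]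
    [Module (MvPolynomial (Fin n) K) M] (ℳ : ℤ → AddSubgroup M) (N : Type w) [AddCommGroup N]
    [Module (MvPolynomial (Fin n) K) N] (i : ℕ) :
    Submodule (MvPolynomial (Fin n) K)
      (StdFree K n ℳ i ⊗[MvPolynomial (Fin n) K] N) :=
  LinearMap.range (LinearMap.rTensor N (stdD K n ℳ i))

/-- `Tor_i^R(M, N)` for `R = K[X_1, …, X_n]`, the `i`-th homology of `F_• ⊗_R N`. -/
abbrev Tor (K : Type u) [Field K] (n : ℕ) {M : Type v} [AddCommGroup M]
    [Module (MvPolynomial (Fin n) K) M] (ℳ : ℤ → AddSubgroup M) (N : Type w) [AddCommGroup N]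
    [Module (MvPolynomial (Fin n) K) N] (i : ℕ) : Type (max u v w) :=
  Subquotient (MvPolynomial (Fin n) K) (StdFree K n ℳ i ⊗[MvPolynomial (Fin n) K] N)
    (torZ K n ℳ N i) (torB K n ℳ N i)

/-- The graded piece `Tor_i^R(M, N)_e`. -/
def torGrading (K : Type u) [Field K] (n : ℕ) {M : Type v} [AddCommGroup M]
    [Module (MvPolynomial (Fin n) K) M] {N : Type w} [AddCommGroup N]
    [Module (MvPolynomial (Fin n) K) N] (ℳ : ℤ → AddSubgroup M) (𝒩 : ℤ → AddSubgroup N)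
    (i : ℕ) (e : ℤ) : AddSubgroup (Tor K n ℳ N i) :=
  subquotientGrading (MvPolynomial (Fin n) K) (StdFree K n ℳ i ⊗[MvPolynomial (Fin n) K] N)
    (tensorGrading K n (freeGrading K n (stdResolution K n ℳ i).deg) 𝒩)
    (torZ K n ℳ N i) (torB K n ℳ N i) e

end

end GradedReg

namespace GradedReg

noncomputable section

variable {K : Type u} [Field K] {n : ℕ}

/-! ### Monomials -/

/-! The idea is to resolve `M` by graded free modules whose generators in step `k` have degree at
most `m + k`, tensor with `N`, and chase local cohomology through the resulting complex. For the
`k`-th term `⨁ N(-d_b)`, with all `d_b ≤ m + k`, the degree `e` part of `H^{j+k}` is a sum of pieces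
of `H^{j+k}(N)` in degrees at least `e - m - k`. These degrees exceed `s - (j + k)` as soon as `e >
m + s - j`, so the pieces vanish. The homology of the complex in position `i > 0` is controlled by
`Tor_i(M, N)`, and the hypothesis kills `H^{j+i+1}` of it in degree `e`. Splitting the complex into
short exact sequences gives `H^j` of the cokernel `M ⊗ N` in degree `e`; this is
`DegProj.vanishes_coker_of_complex`.

The resolution exists because a `μ`-regular module is generated in degrees at most `μ`
(`DegProj.Regular.eq_top`), and the kernel of a surjection onto it from a free module with
generators in such degrees is `(μ + 1)`-regular (`DegProj.Regular.ker`). The first fact is the chase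
above applied to the Koszul complex. The second is the long exact sequence together with `H^j(R)_e =
0` for `e > -j` (`polyProj_vanishes`), proved by an explicit contraction of the Čech complex on
Laurent exponents.

`Tor` is computed by a standard resolution that has generators in all degrees. The bounded
resolution is found inside it as a subcomplex, and `exists_keep_retraction` retracts the large
complex onto the small one. Hence the homology of the small complex tensored with `N` is a graded
retract of `Tor`, and inherits its vanishing; no comparison up to homotopy is needed.

Gradings are handled through their projections (`DegProj`), which pass to localizations, Čech
modules, direct sums, submodules and quotients. The vanishing of `H^j(M)_e` then says that the
degree `e` part of every cocycle is a coboundary. -/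

theorem isHomogeneous_totalDegree_of_mem_monomialsIn {S : Finset (Fin n)}
    {t : MvPolynomial (Fin n) K} (ht : t ∈ monomialsIn K n S) :
    t ≠ 0 ∧ t.IsHomogeneous t.totalDegree := by
  induction ht using Submonoid.closure_induction with
  | mem x hx =>
    obtain ⟨i, -, rfl⟩ := hx
    refine ⟨MvPolynomial.X_ne_zero i, ?_⟩
    rw [MvPolynomial.totalDegree_X]
    exact MvPolynomial.isHomogeneous_X K i
  | one =>
    refine ⟨one_ne_zero, ?_⟩
    rw [MvPolynomial.totalDegree_one]
    exact MvPolynomial.isHomogeneous_one (Fin n) K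
  | mul x y _ _ hx hy =>
    have h0 : x * y ≠ 0 := mul_ne_zero hx.1 hy.1
    refine ⟨h0, ?_⟩
    rw [(hx.2.mul hy.2).totalDegree h0]
    exact hx.2.mul hy.2

/-- The degree of a monomial. -/
def monDeg {S : Finset (Fin n)} (t : monomialsIn K n S) : ℕ :=
  (t : MvPolynomial (Fin n) K).totalDegree

theorem isHomogeneous_monDeg {S : Finset (Fin n)} (t : monomialsIn K n S) :
    (t : MvPolynomial (Fin n) K).IsHomogeneous (monDeg t) :=
  (isHomogeneous_totalDegree_of_mem_monomialsIn t.2).2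

theorem eq_monDeg {S : Finset (Fin n)} (t : monomialsIn K n S) {k : ℕ}
    (h : (t : MvPolynomial (Fin n) K).IsHomogeneous k) : k = monDeg t :=
  (h.totalDegree (isHomogeneous_totalDegree_of_mem_monomialsIn t.2).1).symm

theorem monDeg_mul {S : Finset (Fin n)} (t t' : monomialsIn K n S) :
    monDeg (t * t') = monDeg t + monDeg t' :=
  (eq_monDeg (t * t') ((isHomogeneous_monDeg t).mul (isHomogeneous_monDeg t'))).symm

theorem monDeg_one {S : Finset (Fin n)} : monDeg (1 : monomialsIn K n S) = 0 :=
  (eq_monDeg (1 : monomialsIn K n S) (MvPolynomial.isHomogeneous_one (Fin n) K)).symm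

/-! ### Gradings given by projections -/

/-- A grading of a module over `K[X_1, …, X_n]`, given by the projections to its homogeneous
parts. -/
structure DegProj (K : Type u) [Field K] (n : ℕ) (M : Type v) [AddCommGroup M]
    [Module (MvPolynomial (Fin n) K) M] where
  p : ℤ → M →+ M
  idem : ∀ (d : ℤ) (x : M), p d (p d x) = p d x
  orth : ∀ (d d' : ℤ) (x : M), d ≠ d' → p d (p d' x) = 0
  smul : ∀ (k : ℕ) (d : ℤ) (f : MvPolynomial (Fin n) K) (x : M),
    f.IsHomogeneous k → p (k + d) (f • x) = f • p d x

section

variable {M : Type v} [AddCommGroup M] [Module (MvPolynomial (Fin n) K) M]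

theorem locMap_mk {S T : Finset (Fin n)} (h : S ⊆ T) (x : M) (t : monomialsIn K n S) :
    locMap K n M h (LocalizedModule.mk x t) =
      LocalizedModule.mk x ⟨t.1, monomialsIn_mono K n h t.2⟩ := by
  rw [locMap, IsLocalizedModule.mk_eq_mk', IsLocalizedModule.liftOfLE_mk',
    IsLocalizedModule.mk_eq_mk']

theorem locMap_self (S : Finset (Fin n)) (z : Loc K n M S) :
    locMap K n M (Finset.Subset.refl S) z = z := by
  induction z using LocalizedModule.induction_on with
  | h x t => rw [locMap_mk]

theorem locMap_locMap {S T U : Finset (Fin n)} (h : S ⊆ T) (h' : T ⊆ U) (z : Loc K n M S) :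
    locMap K n M h' (locMap K n M h z) = locMap K n M (h.trans h') z := by
  induction z using LocalizedModule.induction_on with
  | h x t => simp only [locMap_mk]

/-- The projection of `M_{x_S}` to its part of degree `e`. -/
def DegProj.loc (P : DegProj K n M) (S : Finset (Fin n)) (e : ℤ) : Loc K n M S →+ Loc K n M S where
  toFun z := z.liftOn (fun q => LocalizedModule.mk (P.p (monDeg q.2 + e) q.1) q.2) (by
    rintro ⟨x, t⟩ ⟨x', t'⟩ ⟨c, hc⟩
    simp only at hc ⊢
    rw [LocalizedModule.mk_eq]
    refine ⟨c, ?_⟩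
    simp only [Submonoid.smul_def, ← mul_smul] at hc ⊢
    -- Homogeneous multipliers pass through the projection up to a shift of degree, so both sides
    -- become the same graded part of the two equal products.
    rw [← P.smul (monDeg c + monDeg t') _ _ _ ((isHomogeneous_monDeg c).mul
      (isHomogeneous_monDeg t')), hc, ← P.smul (monDeg c + monDeg t) _ _ _
      ((isHomogeneous_monDeg c).mul (isHomogeneous_monDeg t))]
    congr 2
    push_cast
    ring)
  map_zero' := by
    rw [← LocalizedModule.zero_mk 1, LocalizedModule.liftOn_mk]
    simp only [map_zero]
  map_add' z z' := by
    induction z, z' using LocalizedModule.induction_on₂ with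
    | h x x' t t' =>
    simp only [LocalizedModule.mk_add_mk, LocalizedModule.liftOn_mk]
    congr 1
    rw [map_add, monDeg_mul, Submonoid.smul_def, Submonoid.smul_def, Submonoid.smul_def,
      Submonoid.smul_def, ← P.smul _ _ _ _ (isHomogeneous_monDeg t'),
      ← P.smul _ _ _ _ (isHomogeneous_monDeg t)]
    congr 3 <;> · push_cast; ring

theorem DegProj.loc_mk (P : DegProj K n M) {S : Finset (Fin n)} (e : ℤ) (x : M)
    (t : monomialsIn K n S) :
    P.loc S e (LocalizedModule.mk x t) = LocalizedModule.mk (P.p (monDeg t + e) x) t := rfl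

theorem DegProj.loc_idem (P : DegProj K n M) (S : Finset (Fin n)) (e : ℤ) (z : Loc K n M S) :
    P.loc S e (P.loc S e z) = P.loc S e z := by
  induction z using LocalizedModule.induction_on with
  | h x t => rw [P.loc_mk, P.loc_mk, P.idem]

theorem DegProj.loc_locMap (P : DegProj K n M) {S T : Finset (Fin n)} (h : S ⊆ T) (e : ℤ)
    (z : Loc K n M S) : P.loc T e (locMap K n M h z) = locMap K n M h (P.loc S e z) := by
  induction z using LocalizedModule.induction_on with
  | h x t =>
    rw [P.loc_mk, locMap_mk, locMap_mk, P.loc_mk]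
    rfl

/-- The projection of the Čech module to its part of degree `e`. -/
def DegProj.cech (P : DegProj K n M) (j : ℕ) (e : ℤ) : Cech K n M j →+ Cech K n M j where
  toFun ψ S := P.loc S.1 e (ψ S)
  map_zero' := by ext S; simp
  map_add' ψ φ := by ext S; simp

theorem DegProj.cech_apply (P : DegProj K n M) (j : ℕ) (e : ℤ) (ψ : Cech K n M j)
    (S : {S : Finset (Fin n) // S.card = j}) : P.cech j e ψ S = P.loc S.1 e (ψ S) := rfl

theorem DegProj.cech_idem (P : DegProj K n M) (j : ℕ) (e : ℤ) (ψ : Cech K n M j) :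
    P.cech j e (P.cech j e ψ) = P.cech j e ψ := by
  ext S
  simp only [P.cech_apply, P.loc_idem]

theorem cechD_apply (j : ℕ) (ψ : Cech K n M j) (T : {T : Finset (Fin n) // T.card = j + 1}) :
    cechD K n M j ψ T = ∑ k : {k // k ∈ T.1},
      ((-1 : MvPolynomial (Fin n) K) ^ (T.1.filter (fun i => i < k.1)).card) •
        locMap K n M (Finset.erase_subset k.1 T.1)
          (ψ ⟨T.1.erase k.1, by rw [Finset.card_erase_of_mem k.2, T.2]; rfl⟩) := by
  simp [cechD, LinearMap.pi_apply, LinearMap.sum_apply]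

/-! ### Signs, and the square of the Čech differential -/

variable (K) in
/-- `(-1)^{#{i ∈ T | i < k}}` -/
def sgn (k : Fin n) (T : Finset (Fin n)) : MvPolynomial (Fin n) K :=
  (-1) ^ (T.filter (fun i => i < k)).card

/-- Projections to graded parts are additive but not linear over the polynomial ring, so commuting
with signs needs its own argument. -/
theorem map_sgn_smul {A B : Type*} [AddCommGroup A] [Module (MvPolynomial (Fin n) K) A]
    [AddCommGroup B] [Module (MvPolynomial (Fin n) K) B] (f : A →+ B) (k : Fin n)
    (T : Finset (Fin n)) (x : A) : f (sgn K k T • x) = sgn K k T • f x := by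
  rcases neg_one_pow_eq_or (MvPolynomial (Fin n) K) (T.filter (fun i => i < k)).card with h | h <;>
    simp [sgn, h]

theorem sgn_mul_self (k : Fin n) (T : Finset (Fin n)) : sgn K k T * sgn K k T = 1 := by
  rw [sgn, ← mul_pow]; simp

/-- Removing the smaller index changes the position of the larger one by one, and not conversely.
This one rule underlies all sign computations for the Čech and Koszul complexes. -/
theorem sgn_mul_sgn_erase {j k : Fin n} {T : Finset (Fin n)} (hj : j ∈ T) (hk : k ∈ T)
    (hjk : j ≠ k) : sgn K j T * sgn K k (T.erase j) = -(sgn K k T * sgn K j (T.erase k)) := by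
  have aux : ∀ {j k : Fin n}, j ∈ T → j < k →
      sgn K k T = - sgn K k (T.erase j) ∧ sgn K j (T.erase k) = sgn K j T := by
    intro j k hj hlt
    constructor
    · rw [sgn, sgn, Finset.filter_erase, ← Finset.card_erase_add_one
        (Finset.mem_filter.mpr ⟨hj, hlt⟩ : j ∈ T.filter (fun i => i < k)), pow_succ]
      ring
    · rw [sgn, sgn, Finset.filter_erase, Finset.erase_eq_of_notMem]
      simp [hlt.le]
  rcases lt_or_gt_of_ne hjk with h | h
  · obtain ⟨h1, h2⟩ := aux hj h
    rw [h1, h2]; ring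
  · obtain ⟨h1, h2⟩ := aux hk h
    rw [h1, h2]; ring

/-- The component of a Čech cochain at `S`, mapped to `M_{x_T}`; it is `0` if this makes no
sense. -/
def cechCoeff {j : ℕ} (ψ : Cech K n M j) (S T : Finset (Fin n)) : Loc K n M T :=
  if h : S.card = j ∧ S ⊆ T then locMap K n M h.2 (ψ ⟨S, h.1⟩) else 0

theorem cechCoeff_self {j : ℕ} (ψ : Cech K n M j) (S : {S : Finset (Fin n) // S.card = j}) :
    cechCoeff ψ S.1 S.1 = ψ S := by
  rw [cechCoeff, dif_pos ⟨S.2, subset_rfl⟩]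
  exact locMap_self _ _

theorem locMap_cechCoeff {j : ℕ} (ψ : Cech K n M j) {S T U : Finset (Fin n)} (hST : S ⊆ T)
    (h : T ⊆ U) : locMap K n M h (cechCoeff ψ S T) = cechCoeff ψ S U := by
  rw [cechCoeff, cechCoeff]
  by_cases hS : S.card = j
  · rw [dif_pos ⟨hS, hST⟩, dif_pos ⟨hS, hST.trans h⟩, locMap_locMap]
  · rw [dif_neg fun h => hS h.1, dif_neg fun h => hS h.1, map_zero]

theorem cechD_apply_eq_sum (j : ℕ) (ψ : Cech K n M j)
    (T : {T : Finset (Fin n) // T.card = j + 1}) :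
    cechD K n M j ψ T = ∑ k ∈ T.1, sgn K k T.1 • cechCoeff ψ (T.1.erase k) T.1 := by
  rw [cechD_apply, ← Finset.sum_coe_sort T.1]
  refine Finset.sum_congr rfl fun k _ => ?_
  rw [cechCoeff, dif_pos ⟨by rw [Finset.card_erase_of_mem k.2, T.2]; rfl, Finset.erase_subset _ _⟩]
  rfl

theorem cechD_cechD (j : ℕ) (ψ : Cech K n M j) :
    cechD K n M (j + 1) (cechD K n M j ψ) = 0 := by
  ext T
  have key : cechD K n M (j + 1) (cechD K n M j ψ) T =
      ∑ k ∈ T.1, ∑ l ∈ T.1.erase k, (sgn K k T.1 * sgn K l (T.1.erase k)) •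
        cechCoeff ψ ((T.1.erase k).erase l) T.1 := by
    rw [cechD_apply_eq_sum]
    refine Finset.sum_congr rfl fun k hk => ?_
    have hc : (T.1.erase k).card = j + 1 := by rw [Finset.card_erase_of_mem hk, T.2]; rfl
    have h1 : cechCoeff (cechD K n M j ψ) (T.1.erase k) T.1 =
        locMap K n M (Finset.erase_subset k T.1) (cechD K n M j ψ ⟨T.1.erase k, hc⟩) := by
      rw [cechCoeff, dif_pos ⟨hc, Finset.erase_subset _ _⟩]
    rw [h1, cechD_apply_eq_sum, map_sum, Finset.smul_sum]
    refine Finset.sum_congr rfl fun l _ => ?_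
    rw [map_smul, locMap_cechCoeff _ (Finset.erase_subset l _), mul_smul]
  rw [key, Finset.sum_sigma', Pi.zero_apply]
  -- Removing two indices in either order gives the same component with opposite signs.
  refine Finset.sum_involution (fun x _ => ⟨x.2, x.1⟩) ?_ ?_ ?_ ?_
  · rintro ⟨k, l⟩ h
    simp only [Finset.mem_sigma, Finset.mem_erase] at h
    simp only
    rw [sgn_mul_sgn_erase h.1 h.2.2 (Ne.symm h.2.1), Finset.erase_right_comm, neg_smul,
      neg_add_cancel]
  · rintro ⟨k, l⟩ h _ h'
    simp only [Finset.mem_sigma, Finset.mem_erase] at h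
    simp only [Sigma.mk.injEq, heq_eq_eq] at h'
    exact h.2.1 h'.1
  · rintro ⟨k, l⟩ h
    simp only [Finset.mem_sigma, Finset.mem_erase] at h ⊢
    exact ⟨h.2.2, Ne.symm h.2.1, h.1⟩
  · rintro ⟨k, l⟩ _
    rfl

theorem DegProj.cech_cechD (P : DegProj K n M) (j : ℕ) (e : ℤ) (ψ : Cech K n M j) :
    P.cech (j + 1) e (cechD K n M j ψ) = cechD K n M j (P.cech j e ψ) := by
  ext T
  simp only [P.cech_apply, cechD_apply, map_sum]
  exact Finset.sum_congr rfl fun k _ => by rw [← sgn, map_sgn_smul, P.loc_locMap]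

theorem cechD_eq_zero_of_mem_cechB {j : ℕ} {ψ : Cech K n M j} (h : ψ ∈ cechB K n M j) :
    cechD K n M j ψ = 0 := by
  cases j with
  | zero => rw [(Submodule.mem_bot _).mp h, map_zero]
  | succ j =>
    obtain ⟨φ, rfl⟩ := h
    exact cechD_cechD j φ

theorem DegProj.cech_mem_cechB (P : DegProj K n M) {j : ℕ} (e : ℤ) {ψ : Cech K n M j}
    (h : ψ ∈ cechB K n M j) : P.cech j e ψ ∈ cechB K n M j := by
  cases j with
  | zero => rw [(Submodule.mem_bot _).mp h, map_zero]; exact zero_mem _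
  | succ j =>
    obtain ⟨φ, rfl⟩ := h
    exact ⟨P.cech j e φ, (P.cech_cechD j e φ).symm⟩

end

/-! ### Functoriality of the Čech complex -/

section

variable {M : Type v} [AddCommGroup M] [Module (MvPolynomial (Fin n) K) M]
variable {N : Type w} [AddCommGroup N] [Module (MvPolynomial (Fin n) K) N]

/-- The map induced by a linear map on the localizations. -/
def locHom (f : M →ₗ[MvPolynomial (Fin n) K] N) (S : Finset (Fin n)) :
    Loc K n M S →ₗ[MvPolynomial (Fin n) K] Loc K n N S :=
  IsLocalizedModule.map (monomialsIn K n S) (LocalizedModule.mkLinearMap (monomialsIn K n S) M)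
    (LocalizedModule.mkLinearMap (monomialsIn K n S) N) f

theorem locHom_mk (f : M →ₗ[MvPolynomial (Fin n) K] N) {S : Finset (Fin n)} (x : M)
    (t : monomialsIn K n S) :
    locHom f S (LocalizedModule.mk x t) = LocalizedModule.mk (f x) t := by
  rw [locHom, IsLocalizedModule.mk_eq_mk', IsLocalizedModule.map_mk',
    IsLocalizedModule.mk_eq_mk']

theorem locHom_locMap (f : M →ₗ[MvPolynomial (Fin n) K] N) {S T : Finset (Fin n)} (h : S ⊆ T)
    (z : Loc K n M S) : locHom f T (locMap K n M h z) = locMap K n N h (locHom f S z) := by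
  induction z using LocalizedModule.induction_on with
  | h x t => simp only [locMap_mk, locHom_mk]

/-- The map induced by a linear map on the Čech modules. -/
def cechMap (f : M →ₗ[MvPolynomial (Fin n) K] N) (j : ℕ) :
    Cech K n M j →ₗ[MvPolynomial (Fin n) K] Cech K n N j :=
  LinearMap.pi fun S => locHom f S.1 ∘ₗ LinearMap.proj S

theorem cechMap_apply (f : M →ₗ[MvPolynomial (Fin n) K] N) (j : ℕ) (ψ : Cech K n M j)
    (S : {S : Finset (Fin n) // S.card = j}) : cechMap f j ψ S = locHom f S.1 (ψ S) := rfl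

theorem cechMap_cechD (f : M →ₗ[MvPolynomial (Fin n) K] N) (j : ℕ) (ψ : Cech K n M j) :
    cechMap f (j + 1) (cechD K n M j ψ) = cechD K n N j (cechMap f j ψ) := by
  ext T
  simp only [cechMap_apply, cechD_apply, map_sum, map_smul, locHom_locMap]

theorem cechMap_mem_cechB (f : M →ₗ[MvPolynomial (Fin n) K] N) {j : ℕ} {ψ : Cech K n M j}
    (h : ψ ∈ cechB K n M j) : cechMap f j ψ ∈ cechB K n N j := by
  cases j with
  | zero => rw [(Submodule.mem_bot _).mp h, map_zero]; exact zero_mem _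
  | succ j =>
    obtain ⟨φ, rfl⟩ := h
    exact ⟨cechMap f j φ, (cechMap_cechD f j φ).symm⟩

theorem cechMap_injective {f : M →ₗ[MvPolynomial (Fin n) K] N} (hf : Function.Injective f)
    (j : ℕ) : Function.Injective (cechMap f j) := by
  intro ψ φ h
  ext S
  exact IsLocalizedModule.map_injective _ _ _ f hf (congrFun h S)

theorem cechMap_surjective {f : M →ₗ[MvPolynomial (Fin n) K] N} (hf : Function.Surjective f)
    (j : ℕ) : Function.Surjective (cechMap f j) := by
  intro ψ
  choose φ hφ using fun S : {S : Finset (Fin n) // S.card = j} =>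
    IsLocalizedModule.map_surjective (monomialsIn K n S.1)
      (LocalizedModule.mkLinearMap (monomialsIn K n S.1) M)
      (LocalizedModule.mkLinearMap (monomialsIn K n S.1) N) f hf (ψ S)
  exact ⟨φ, funext hφ⟩

theorem exists_mem_cechB_cechMap_eq {f : M →ₗ[MvPolynomial (Fin n) K] N}
    (hf : Function.Surjective f) {j : ℕ} {ψ : Cech K n N j} (h : ψ ∈ cechB K n N j) :
    ∃ φ ∈ cechB K n M j, cechMap f j φ = ψ := by
  cases j with
  | zero => exact ⟨0, zero_mem _, by rw [(Submodule.mem_bot _).mp h, map_zero]⟩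
  | succ j =>
    obtain ⟨η, rfl⟩ := h
    obtain ⟨φ, rfl⟩ := cechMap_surjective hf j η
    exact ⟨cechD K n M j φ, ⟨φ, rfl⟩, cechMap_cechD f j φ⟩

theorem DegProj.cech_cechMap (P : DegProj K n M) (Q : DegProj K n N)
    {f : M →ₗ[MvPolynomial (Fin n) K] N} {c : ℤ} (hf : ∀ d x, Q.p (d + c) (f x) = f (P.p d x))
    (j : ℕ) (e : ℤ) (ψ : Cech K n M j) :
    Q.cech j (e + c) (cechMap f j ψ) = cechMap f j (P.cech j e ψ) := by
  ext S
  simp only [cechMap_apply, DegProj.cech_apply]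
  induction ψ S using LocalizedModule.induction_on with
  | h x t => rw [locHom_mk, Q.loc_mk, P.loc_mk, locHom_mk, ← hf, add_assoc]

theorem cechMap_id (j : ℕ) (ψ : Cech K n M j) : cechMap LinearMap.id j ψ = ψ := by
  ext S
  rw [cechMap_apply]
  induction ψ S using LocalizedModule.induction_on with
  | h x t => rw [locHom_mk]; rfl

end

section

variable {A B C : Type*} [AddCommGroup A] [Module (MvPolynomial (Fin n) K) A]
  [AddCommGroup B] [Module (MvPolynomial (Fin n) K) B]
  [AddCommGroup C] [Module (MvPolynomial (Fin n) K) C]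
  {f : A →ₗ[MvPolynomial (Fin n) K] B} {g : B →ₗ[MvPolynomial (Fin n) K] C}

theorem cechMap_comp (f : A →ₗ[MvPolynomial (Fin n) K] B) (g : B →ₗ[MvPolynomial (Fin n) K] C)
    (j : ℕ) (ψ : Cech K n A j) : cechMap (g ∘ₗ f) j ψ = cechMap g j (cechMap f j ψ) := by
  ext S
  simp only [cechMap_apply]
  induction ψ S using LocalizedModule.induction_on with
  | h x t => simp only [locHom_mk]; rfl

theorem cechMap_exact (h : Function.Exact f g) (j : ℕ) :
    Function.Exact (cechMap f j) (cechMap g j) := by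
  intro ψ
  have hex := fun S : {S : Finset (Fin n) // S.card = j} =>
    IsLocalizedModule.map_exact (monomialsIn K n S.1)
      (LocalizedModule.mkLinearMap (monomialsIn K n S.1) A)
      (LocalizedModule.mkLinearMap (monomialsIn K n S.1) B)
      (LocalizedModule.mkLinearMap (monomialsIn K n S.1) C) f g h
  constructor
  · intro h0
    choose φ hφ using fun S : {S : Finset (Fin n) // S.card = j} =>
      (hex S (ψ S)).mp (congrFun h0 S)
    exact ⟨φ, funext hφ⟩
  · rintro ⟨φ, rfl⟩
    ext S
    exact (hex S _).mpr ⟨φ S, rfl⟩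

/-! ### Vanishing of local cohomology and the long exact sequence -/

/-- `H^j_{R_+}(M)_e = 0`. -/
def DegProj.Vanishes (P : DegProj K n A) (j : ℕ) (e : ℤ) : Prop :=
  ∀ ψ : Cech K n A j, cechD K n A j ψ = 0 → P.cech j e ψ ∈ cechB K n A j

variable {PA : DegProj K n A} {PB : DegProj K n B} {PC : DegProj K n C}

theorem DegProj.vanishes_of_lt (P : DegProj K n A) {j : ℕ} (hj : n < j) (e : ℤ) :
    P.Vanishes j e := by
  intro ψ _
  have : P.cech j e ψ = 0 := by
    ext S
    have h := S.1.card_le_univ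
    rw [S.2, Fintype.card_fin] at h
    omega
  rw [this]
  exact zero_mem _

/-- The piece `H^j(B) → H^j(C) → H^{j+1}(A)` of the long exact sequence in degree `e`. The chase
uses inhomogeneous lifts, and idempotence of the projections restores the degree at the end. -/
theorem DegProj.Vanishes.right (hf : Function.Injective f) (hg : Function.Surjective g)
    (hfg : Function.Exact f g) (hPf : ∀ d x, PB.p d (f x) = f (PA.p d x))
    (hPg : ∀ d x, PC.p d (g x) = g (PB.p d x)) {j : ℕ} {e : ℤ} (hB : PB.Vanishes j e)
    (hA : PA.Vanishes (j + 1) e) : PC.Vanishes j e := by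
  have hf' : ∀ j ψ, PB.cech j e (cechMap f j ψ) = cechMap f j (PA.cech j e ψ) := fun j ψ => by
    simpa using PA.cech_cechMap PB (c := 0) (by simpa using hPf) j e ψ
  have hg' : ∀ j ψ, PC.cech j e (cechMap g j ψ) = cechMap g j (PB.cech j e ψ) := fun j ψ => by
    simpa using PB.cech_cechMap PC (c := 0) (by simpa using hPg) j e ψ
  intro ψ hψ
  obtain ⟨φ, rfl⟩ := cechMap_surjective hg j ψ
  rw [← cechMap_cechD] at hψ
  obtain ⟨α, hα⟩ := (cechMap_exact hfg (j + 1) _).mp hψ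
  have hdα : cechD K n A (j + 1) α = 0 := by
    apply cechMap_injective hf
    rw [cechMap_cechD, hα, cechD_cechD, map_zero]
  obtain ⟨β, hβ⟩ := hA α hdα
  -- Correcting the lift by `β` turns it into a cocycle without changing its image in `C`.
  have h1 : cechD K n B j (PB.cech j e φ - cechMap f j β) = 0 := by
    rw [map_sub, ← PB.cech_cechD, ← hα, hf', ← cechMap_cechD, hβ, sub_self]
  have h2 := cechMap_mem_cechB g (hB _ h1)
  rwa [← hg', map_sub, (cechMap_exact hfg j).apply_apply_eq_zero, sub_zero, ← hg',
    PC.cech_idem] at h2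

theorem DegProj.Vanishes.middle (hf : Function.Injective f) (hg : Function.Surjective g)
    (hfg : Function.Exact f g) (hPf : ∀ d x, PB.p d (f x) = f (PA.p d x))
    (hPg : ∀ d x, PC.p d (g x) = g (PB.p d x)) {j : ℕ} {e : ℤ} (hA : PA.Vanishes j e)
    (hC : PC.Vanishes j e) : PB.Vanishes j e := by
  have hf' : ∀ j ψ, PB.cech j e (cechMap f j ψ) = cechMap f j (PA.cech j e ψ) := fun j ψ => by
    simpa using PA.cech_cechMap PB (c := 0) (by simpa using hPf) j e ψ
  have hg' : ∀ j ψ, PC.cech j e (cechMap g j ψ) = cechMap g j (PB.cech j e ψ) := fun j ψ => by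
    simpa using PB.cech_cechMap PC (c := 0) (by simpa using hPg) j e ψ
  intro ψ hψ
  have h0 := hC (cechMap g j ψ) (by rw [← cechMap_cechD, hψ, map_zero])
  obtain ⟨φ, hφ, hφ'⟩ := exists_mem_cechB_cechMap_eq hg h0
  obtain ⟨α, hα⟩ := (cechMap_exact hfg j (PB.cech j e ψ - φ)).mp (by
    rw [map_sub, hφ', hg', sub_self])
  have hdα : cechD K n A j α = 0 := by
    apply cechMap_injective hf
    rw [cechMap_cechD, hα, map_sub, cechD_eq_zero_of_mem_cechB hφ, ← PB.cech_cechD, hψ, map_zero,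
      map_zero, sub_zero]
  have h1 := cechMap_mem_cechB f (hA α hdα)
  rw [← hf', hα, map_sub, PB.cech_idem] at h1
  simpa using add_mem h1 (PB.cech_mem_cechB e hφ)

/-- The piece `H^j(C) → H^{j+1}(A) → H^{j+1}(B)` of the long exact sequence. -/
theorem DegProj.Vanishes.left (hf : Function.Injective f) (hg : Function.Surjective g)
    (hfg : Function.Exact f g) (hPf : ∀ d x, PB.p d (f x) = f (PA.p d x))
    (hPg : ∀ d x, PC.p d (g x) = g (PB.p d x)) {j : ℕ} {e : ℤ} (hC : PC.Vanishes j e)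
    (hB : PB.Vanishes (j + 1) e) : PA.Vanishes (j + 1) e := by
  have hf' : ∀ j ψ, PB.cech j e (cechMap f j ψ) = cechMap f j (PA.cech j e ψ) := fun j ψ => by
    simpa using PA.cech_cechMap PB (c := 0) (by simpa using hPf) j e ψ
  have hg' : ∀ j ψ, PC.cech j e (cechMap g j ψ) = cechMap g j (PB.cech j e ψ) := fun j ψ => by
    simpa using PB.cech_cechMap PC (c := 0) (by simpa using hPg) j e ψ
  intro α hα
  obtain ⟨β, hβ⟩ := hB (cechMap f (j + 1) α) (by rw [← cechMap_cechD, hα, map_zero])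
  rw [hf'] at hβ
  have h0 := hC (cechMap g j β) (by
    rw [← cechMap_cechD, hβ, (cechMap_exact hfg (j + 1)).apply_apply_eq_zero])
  obtain ⟨φ, hφ, hφ'⟩ := exists_mem_cechB_cechMap_eq hg h0
  obtain ⟨η, hη⟩ := (cechMap_exact hfg j (PB.cech j e β - φ)).mp (by
    rw [map_sub, hφ', hg', sub_self])
  refine ⟨η, ?_⟩
  apply cechMap_injective hf
  rw [cechMap_cechD, hη, map_sub, cechD_eq_zero_of_mem_cechB hφ, sub_zero, ← PB.cech_cechD, hβ,
    hf', PA.cech_idem]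

theorem DegProj.Vanishes.zero_left (hf : Function.Injective f)
    (hPf : ∀ d x, PB.p d (f x) = f (PA.p d x)) {e : ℤ}
    (hB : PB.Vanishes 0 e) : PA.Vanishes 0 e := by
  intro α hα
  have h := hB (cechMap f 0 α) (by rw [← cechMap_cechD, hα, map_zero])
  have hf' : PB.cech 0 e (cechMap f 0 α) = cechMap f 0 (PA.cech 0 e α) := by
    simpa using PA.cech_cechMap PB (c := 0) (by simpa using hPf) 0 e α
  rw [hf'] at h
  refine (Submodule.mem_bot _).mpr (cechMap_injective hf 0 ?_)
  rw [(Submodule.mem_bot _).mp h, map_zero]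

end

section

variable {M : Type v} [AddCommGroup M] [Module (MvPolynomial (Fin n) K) M]

/-! ### Constructions of gradings -/

/-- Every element is the finite sum of its homogeneous components. -/
def DegProj.Total (P : DegProj K n M) : Prop :=
  ∀ x : M, ∃ s : Finset ℤ, ∀ s' : Finset ℤ, s ⊆ s' → x = ∑ d ∈ s', P.p d x

/-- The grading of a homogeneous submodule. -/
def DegProj.restrict (P : DegProj K n M) (Z : Submodule (MvPolynomial (Fin n) K) M)
    (hZ : ∀ d, ∀ x ∈ Z, P.p d x ∈ Z) : DegProj K n Z where
  p d := ((P.p d).comp Z.subtype.toAddMonoidHom).codRestrict Z fun x => hZ d x x.2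
  idem d x := Subtype.ext (P.idem d x)
  orth d d' x h := Subtype.ext (P.orth d d' x h)
  smul k d f x hf := Subtype.ext (P.smul k d f x hf)

theorem DegProj.Total.restrict {P : DegProj K n M} (hP : P.Total)
    (Z : Submodule (MvPolynomial (Fin n) K) M) (hZ : ∀ d, ∀ x ∈ Z, P.p d x ∈ Z) :
    (P.restrict Z hZ).Total := by
  intro x
  obtain ⟨s, hs⟩ := hP x
  refine ⟨s, fun s' h => Subtype.ext ?_⟩
  rw [AddSubmonoidClass.coe_finsetSum]
  exact hs s' h

/-- The grading of the quotient by a homogeneous submodule. -/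
def DegProj.quotient (P : DegProj K n M) (B : Submodule (MvPolynomial (Fin n) K) M)
    (hB : ∀ d, ∀ x ∈ B, P.p d x ∈ B) : DegProj K n (M ⧸ B) where
  p d := QuotientAddGroup.map B.toAddSubgroup B.toAddSubgroup (P.p d) fun x hx => hB d x hx
  idem d x := by
    obtain ⟨x, rfl⟩ := B.mkQ_surjective x
    exact congrArg B.mkQ (P.idem d x)
  orth d d' x h := by
    obtain ⟨x, rfl⟩ := B.mkQ_surjective x
    exact (congrArg B.mkQ (P.orth d d' x h)).trans (map_zero _)
  smul k d f x hf := by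
    obtain ⟨x, rfl⟩ := B.mkQ_surjective x
    exact congrArg B.mkQ (P.smul k d f x hf)

theorem DegProj.quotient_mkQ (P : DegProj K n M) (B : Submodule (MvPolynomial (Fin n) K) M)
    (hB : ∀ d, ∀ x ∈ B, P.p d x ∈ B) (d : ℤ) (x : M) :
    (P.quotient B hB).p d (B.mkQ x) = B.mkQ (P.p d x) := rfl

/-- The grading of the subquotient by homogeneous submodules. -/
def DegProj.subquotient (P : DegProj K n M) (Z B : Submodule (MvPolynomial (Fin n) K) M)
    (hZ : ∀ d, ∀ x ∈ Z, P.p d x ∈ Z) (hB : ∀ d, ∀ x ∈ B, P.p d x ∈ B) :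
    DegProj K n (Subquotient (MvPolynomial (Fin n) K) M Z B) :=
  (P.restrict Z hZ).quotient (B.submoduleOf Z) fun d x hx => hB d x hx

/-- The projections are the components of the direct sum decomposition; compatibility with
multiplication is checked on homogeneous elements. -/
theorem exists_degProj_of_isGrading {ℳ : ℤ → AddSubgroup M} (h : IsGrading K n ℳ) :
    ∃ P : DegProj K n M, P.Total ∧ (∀ d x, P.p d x ∈ ℳ d) ∧ ∀ d, ∀ x ∈ ℳ d, P.p d x = x := by
  classical
  let D := h.isInternal.chooseDecomposition
  have hsame : ∀ d x, x ∈ ℳ d → (DirectSum.decompose ℳ x d : M) = x := fun d x hx =>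
    DirectSum.decompose_of_mem_same ℳ hx
  have hne : ∀ d d' x, x ∈ ℳ d → d ≠ d' → (DirectSum.decompose ℳ x d' : M) = 0 :=
    fun d d' x hx hd => DirectSum.decompose_of_mem_ne ℳ hx hd
  refine ⟨
    { p := fun d =>
        { toFun := fun x => (DirectSum.decompose ℳ x d : M)
          map_zero' := by simp
          map_add' := fun x y => by simp }
      idem := fun d x => hsame d _ (SetLike.coe_mem _)
      orth := fun d d' x h => hne d' d _ (SetLike.coe_mem _) h.symm
      smul := ?_ }, ?_, fun d x => SetLike.coe_mem _, fun d x hx => hsame d x hx⟩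
  · intro k d f x hf
    simp only [AddMonoidHom.coe_mk, ZeroHom.coe_mk]
    induction x using DirectSum.Decomposition.inductionOn ℳ with
    | zero => simp
    | @homogeneous d' x =>
      by_cases hd : d' = d
      · subst hd
        rw [hsame _ _ (h.smul_mem k d' f x hf x.2), hsame _ _ x.2]
      · rw [hne _ _ _ (h.smul_mem k d' f x hf x.2) (by omega), hne _ _ _ x.2 hd, smul_zero]
    | add x y hx hy => simp only [smul_add, DirectSum.decompose_add, DirectSum.add_apply,
        AddSubgroup.coe_add, hx, hy]
  · intro x
    simp only [AddMonoidHom.coe_mk, ZeroHom.coe_mk]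
    refine ⟨(DirectSum.decompose ℳ x).support, fun s' hs' => ?_⟩
    conv_lhs => rw [← DirectSum.sum_support_decompose ℳ x]
    refine Finset.sum_subset hs' fun d _ hd => ?_
    simpa using hd

/-- The grading of `⨁_{b ∈ ι} M(-deg b)`. -/
def DegProj.finsupp (P : DegProj K n M) {ι : Type w} (deg : ι → ℤ) : DegProj K n (ι →₀ M) where
  p e := Finsupp.liftAddHom fun b => (Finsupp.singleAddHom b).comp (P.p (e - deg b))
  idem e x := by
    induction x using Finsupp.induction_linear with
    | zero => simp
    | add f g hf hg => rw [map_add, map_add, hf, hg]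
    | single b x => simp [P.idem]
  orth d d' x h := by
    induction x using Finsupp.induction_linear with
    | zero => simp
    | add f g hf hg => rw [map_add, map_add, hf, hg, add_zero]
    | single b x => simp [P.orth (d - deg b) (d' - deg b) x (by omega)]
  smul k d f x hf := by
    induction x using Finsupp.induction_linear with
    | zero => simp
    | add x y hx hy => rw [smul_add, map_add, hx, hy, map_add, smul_add]
    | single b x =>
      rw [Finsupp.smul_single, Finsupp.liftAddHom_apply_single, Finsupp.liftAddHom_apply_single]
      simp only [AddMonoidHom.comp_apply, Finsupp.singleAddHom_apply, Finsupp.smul_single]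
      rw [add_sub_assoc, P.smul _ _ _ _ hf]

theorem DegProj.finsupp_single (P : DegProj K n M) {ι : Type w} (deg : ι → ℤ) (e : ℤ) (b : ι)
    (x : M) :
    (P.finsupp deg).p e (Finsupp.single b x) = Finsupp.single b (P.p (e - deg b) x) := by
  simp [DegProj.finsupp]

theorem DegProj.finsupp_apply (P : DegProj K n M) {ι : Type w} (deg : ι → ℤ) (e : ℤ) (x : ι →₀ M)
    (b : ι) : (P.finsupp deg).p e x b = P.p (e - deg b) (x b) := by
  classical
  induction x using Finsupp.induction_linear with
  | zero => simp
  | add f g hf hg => simp only [map_add, Finsupp.add_apply, hf, hg]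
  | single c x =>
    rw [P.finsupp_single, Finsupp.single_apply, Finsupp.single_apply]
    split_ifs with h
    · rw [h]
    · rw [map_zero]

theorem DegProj.Total.finsupp {P : DegProj K n M} (hP : P.Total) {ι : Type w} (deg : ι → ℤ) :
    (P.finsupp deg).Total := by
  classical
  intro x
  induction x using Finsupp.induction_linear with
  | zero => exact ⟨∅, fun s' _ => by simp⟩
  | add f g hf hg =>
    obtain ⟨s, hs⟩ := hf
    obtain ⟨t, ht⟩ := hg
    refine ⟨s ∪ t, fun s' h => ?_⟩
    conv_lhs => rw [hs s' (Finset.union_subset_left h), ht s' (Finset.union_subset_right h)]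
    rw [← Finset.sum_add_distrib]
    simp only [map_add]
  | single b x =>
    obtain ⟨s, hs⟩ := hP x
    refine ⟨s.image (· + deg b), fun s' h => ?_⟩
    simp only [P.finsupp_single]
    simp only [← Finsupp.singleAddHom_apply]
    rw [← map_sum (Finsupp.singleAddHom b)]
    congr 1
    have hinj : Set.InjOn (fun e : ℤ => e - deg b) s' := fun e _ e' _ he => by
      simpa using he
    rw [← Finset.sum_image (f := fun d => P.p d x) hinj]
    refine hs _ fun d hd => Finset.mem_image.mpr ⟨d + deg b, h (Finset.mem_image_of_mem _ hd), ?_⟩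
    simp

end

/-! ### The grading of the polynomial ring and of free modules -/

theorem weight_one_eq_degree (s : Fin n →₀ ℕ) : Finsupp.weight (1 : Fin n → ℕ) s = s.degree := by
  rw [Finsupp.degree_eq_weight_one]
  rfl

theorem coeff_ite_homogeneousComponent (d : ℤ) (f : MvPolynomial (Fin n) K) (s : Fin n →₀ ℕ) :
    ((if 0 ≤ d then (MvPolynomial.homogeneousComponent d.toNat).toAddMonoidHom else 0 :
      MvPolynomial (Fin n) K →+ MvPolynomial (Fin n) K) f).coeff s =
        if (s.degree : ℤ) = d then f.coeff s else 0 := by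
  split_ifs with h h' h'
  · exact (MvPolynomial.coeff_homogeneousComponent _ _ _).trans (if_pos (by omega))
  · exact (MvPolynomial.coeff_homogeneousComponent _ _ _).trans (if_neg (by omega))
  · omega
  · simp

/-- The grading of the polynomial ring. -/
def polyProj (K : Type u) [Field K] (n : ℕ) : DegProj K n (MvPolynomial (Fin n) K) where
  p d := if 0 ≤ d then (MvPolynomial.homogeneousComponent d.toNat).toAddMonoidHom else 0
  idem d x := by
    ext s
    simp only [coeff_ite_homogeneousComponent]
    split_ifs <;> rfl
  orth d d' x h := by
    ext s
    simp only [coeff_ite_homogeneousComponent, MvPolynomial.coeff_zero]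
    split_ifs <;> first | rfl | omega
  smul k d f x hf := by
    ext s
    rw [coeff_ite_homogeneousComponent, smul_eq_mul, smul_eq_mul, MvPolynomial.coeff_mul,
      MvPolynomial.coeff_mul]
    have hs : ∀ q ∈ Finset.HasAntidiagonal.antidiagonal s, f.coeff q.1 * ((if 0 ≤ d then
        (MvPolynomial.homogeneousComponent d.toNat).toAddMonoidHom else 0 :
        MvPolynomial (Fin n) K →+ MvPolynomial (Fin n) K) x).coeff q.2 =
        if (s.degree : ℤ) = k + d then f.coeff q.1 * x.coeff q.2 else 0 := by
      intro q hq
      rw [coeff_ite_homogeneousComponent]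
      by_cases h0 : f.coeff q.1 = 0
      · simp [h0]
      · have h1 : q.1.degree = k := by
          have h1 := hf h0
          rwa [weight_one_eq_degree] at h1
        rw [← Finset.HasAntidiagonal.mem_antidiagonal.mp hq, map_add, h1]
        push_cast
        simp only [add_right_inj, mul_ite, mul_zero]
    rw [Finset.sum_congr rfl hs]
    split_ifs
    · rfl
    · rw [Finset.sum_const_zero]

theorem coeff_polyProj (d : ℤ) (f : MvPolynomial (Fin n) K) (s : Fin n →₀ ℕ) :
    ((polyProj K n).p d f).coeff s = if (s.degree : ℤ) = d then f.coeff s else 0 :=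
  coeff_ite_homogeneousComponent d f s

theorem polyProj_total : (polyProj K n).Total := by
  classical
  intro x
  refine ⟨x.support.image fun s => (s.degree : ℤ), fun s' hs' => ?_⟩
  ext s
  rw [MvPolynomial.coeff_sum]
  simp only [coeff_polyProj, Finset.sum_ite_eq]
  split_ifs with h
  · rfl
  · by_contra h0
    exact h (hs' (Finset.mem_image_of_mem _ (MvPolynomial.mem_support_iff.mpr h0)))

theorem isHomogeneous_iff_polyProj {k : ℕ} {f : MvPolynomial (Fin n) K} :
    f.IsHomogeneous k ↔ (polyProj K n).p k f = f := by
  constructor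
  · intro hf
    ext s
    rw [coeff_polyProj]
    split_ifs with h
    · rfl
    · by_contra h0
      have h1 := hf (Ne.symm h0)
      rw [weight_one_eq_degree] at h1
      exact h (by exact_mod_cast h1)
  · intro h s hs
    rw [← h, coeff_polyProj] at hs
    rw [weight_one_eq_degree]
    by_contra h'
    exact hs (if_neg (by exact_mod_cast h'))

theorem polyProj_p_of_neg {d : ℤ} (hd : d < 0) (f : MvPolynomial (Fin n) K) :
    (polyProj K n).p d f = 0 := by
  ext s
  rw [coeff_polyProj, if_neg (by omega), MvPolynomial.coeff_zero]

theorem mem_freeGrading_iff {ι : Type v} (deg : ι → ℤ) (e : ℤ) (x : ι →₀ MvPolynomial (Fin n) K) :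
    x ∈ freeGrading K n deg e ↔ ((polyProj K n).finsupp deg).p e x = x := by
  constructor
  · intro h
    ext b s
    rw [DegProj.finsupp_apply, coeff_polyProj]
    split_ifs with hs
    · rfl
    · by_contra h0
      exact hs (by rw [← h b s (Ne.symm h0)]; ring)
  · intro h b s hs
    rw [← h, DegProj.finsupp_apply, coeff_polyProj] at hs
    by_contra h'
    exact hs (if_neg fun h0 => h' (by rw [h0]; ring))

/-! ### Direct sums of shifts -/

section

variable {M : Type v} [AddCommGroup M] [Module (MvPolynomial (Fin n) K) M]

/-- The numerator of a fraction has finite support. Allowing every larger finite set lets one set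
serve all components of a Čech cochain. -/
theorem exists_eq_sum_locHom {ι : Type w} {S : Finset (Fin n)} (z : Loc K n (ι →₀ M) S) :
    ∃ s : Finset ι, ∀ s' : Finset ι, s ⊆ s' →
      z = ∑ b ∈ s', locHom (Finsupp.lsingle b) S (locHom (Finsupp.lapply b) S z) := by
  classical
  induction z using LocalizedModule.induction_on with
  | h x t =>
    have hmk : ∀ {A : Type (max v w)} [AddCommGroup A] [Module (MvPolynomial (Fin n) K) A]
        (s : Finset ι) (f : ι → A),
        LocalizedModule.mk (∑ b ∈ s, f b) t = ∑ b ∈ s, LocalizedModule.mk (f b) t := by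
      intro A _ _ s f
      simp only [IsLocalizedModule.mk_eq_mk']
      exact map_sum (AddMonoidHom.mk' (fun y : A => IsLocalizedModule.mk'
        (LocalizedModule.mkLinearMap (monomialsIn K n S) A) y t)
        fun a b => IsLocalizedModule.mk'_add _ a b t) f s
    refine ⟨x.support, fun s' hs' => ?_⟩
    simp only [locHom_mk]
    rw [← hmk]
    congr 1
    conv_lhs => rw [← Finsupp.sum_single x]
    exact Finset.sum_subset hs' fun b _ hb => by
      rw [Finsupp.notMem_support_iff.mp hb, Finsupp.single_zero]

theorem exists_eq_sum_cechMap {ι : Type w} {j : ℕ} (ψ : Cech K n (ι →₀ M) j) :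
    ∃ s : Finset ι,
      ψ = ∑ b ∈ s, cechMap (Finsupp.lsingle b) j (cechMap (Finsupp.lapply b) j ψ) := by
  classical
  choose s hs using fun S : {S : Finset (Fin n) // S.card = j} => exists_eq_sum_locHom (ψ S)
  refine ⟨Finset.univ.biUnion s, ?_⟩
  ext S
  rw [Finset.sum_apply]
  exact hs S _ (Finset.subset_biUnion_of_mem s (Finset.mem_univ S))

/-- Local cohomology commutes with direct sums: a cochain has only finitely many nonzero
coordinates, and each coordinate of a cocycle is a cocycle. -/
theorem DegProj.Vanishes.finsupp {P : DegProj K n M} {ι : Type w} {deg : ι → ℤ} {j : ℕ} {e : ℤ}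
    (h : ∀ b, P.Vanishes j (e - deg b)) : (P.finsupp deg).Vanishes j e := by
  intro ψ hψ
  obtain ⟨s, hs⟩ := exists_eq_sum_cechMap ψ
  rw [hs, map_sum]
  refine sum_mem fun b _ => ?_
  have h1 := P.cech_cechMap (P.finsupp deg) (f := Finsupp.lsingle b) (c := deg b)
    (fun d x => by
      rw [Finsupp.lsingle_apply, Finsupp.lsingle_apply, P.finsupp_single, add_sub_cancel_right])
    j (e - deg b) (cechMap (Finsupp.lapply b) j ψ)
  rw [sub_add_cancel] at h1
  rw [h1]
  exact cechMap_mem_cechB _ (h b _ (by rw [← cechMap_cechD, hψ, map_zero]))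

/-! ### Comparison with the gradings by subgroups -/

variable {N : Type w} [AddCommGroup N] [Module (MvPolynomial (Fin n) K) N]

theorem localCohomologyGrading_eq_bot_iff (ℳ : ℤ → AddSubgroup M) (j : ℕ) (e : ℤ) :
    localCohomologyGrading K n ℳ j e = ⊥ ↔
      ∀ ψ ∈ cechGrading K n ℳ j e, cechD K n M j ψ = 0 → ψ ∈ cechB K n M j := by
  constructor
  · intro h ψ hψ hd
    have h1 : ((cechB K n M j).submoduleOf (LinearMap.ker (cechD K n M j))).mkQ ⟨ψ, hd⟩ ∈
        localCohomologyGrading K n ℳ j e := ⟨⟨ψ, hd⟩, hψ, rfl⟩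
    rw [h, AddSubgroup.mem_bot, Submodule.mkQ_apply, Submodule.Quotient.mk_eq_zero] at h1
    exact h1
  · intro h
    rw [eq_bot_iff]
    rintro _ ⟨ψ, hψ, rfl⟩
    rw [AddSubgroup.mem_bot]
    exact (Submodule.Quotient.mk_eq_zero _).mpr (h ψ.1 hψ ψ.2)

theorem cechMap_cech_mem_cechGrading (P : DegProj K n M) {𝒩 : ℤ → AddSubgroup N}
    (f : M →ₗ[MvPolynomial (Fin n) K] N) (h : ∀ d x, f (P.p d x) ∈ 𝒩 d) (j : ℕ) (e : ℤ)
    (ψ : Cech K n M j) : cechMap f j (P.cech j e ψ) ∈ cechGrading K n 𝒩 j e := by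
  intro S _
  change locHom f S.1 (P.loc S.1 e (ψ S)) ∈ locGrading K n 𝒩 S.1 e
  generalize ψ S = z
  induction z using LocalizedModule.induction_on with
  | h x t =>
    rw [P.loc_mk, locHom_mk]
    exact AddSubgroup.subset_closure
      ⟨monDeg t, t, _, isHomogeneous_monDeg t, by rw [add_comm]; exact h _ _, rfl⟩

theorem cech_cechMap_of_mem_cechGrading (P : DegProj K n M) {𝒩 : ℤ → AddSubgroup N}
    (f : N →ₗ[MvPolynomial (Fin n) K] M) (h : ∀ d, ∀ x ∈ 𝒩 d, P.p d (f x) = f x) {j : ℕ} {e : ℤ}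
    {ψ : Cech K n N j} (hψ : ψ ∈ cechGrading K n 𝒩 j e) :
    P.cech j e (cechMap f j ψ) = cechMap f j ψ := by
  ext S
  rw [P.cech_apply, cechMap_apply]
  have hS : ψ S ∈ locGrading K n 𝒩 S.1 e := hψ S (Set.mem_univ S)
  generalize ψ S = z at hS ⊢
  induction hS using AddSubgroup.closure_induction with
  | mem z hz =>
    obtain ⟨k, t, x, ht, hx, rfl⟩ := hz
    rw [locHom_mk, P.loc_mk, h]
    rwa [add_comm, ← eq_monDeg t ht]
  | zero => rw [map_zero, map_zero]
  | add a b _ _ ha hb => rw [map_add, map_add, ha, hb]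
  | neg a _ ha => rw [map_neg, map_neg, ha]

/-- Vanishing of local cohomology passes to retracts. -/
theorem vanishes_of_retract {P : DegProj K n M} {𝒩 : ℤ → AddSubgroup N}
    (f : M →ₗ[MvPolynomial (Fin n) K] N) (g : N →ₗ[MvPolynomial (Fin n) K] M)
    (hgf : g ∘ₗ f = LinearMap.id) (hf : ∀ d x, f (P.p d x) ∈ 𝒩 d) {j : ℕ} {e : ℤ}
    (h : localCohomologyGrading K n 𝒩 j e = ⊥) : P.Vanishes j e := by
  intro ψ hψ
  rw [localCohomologyGrading_eq_bot_iff] at h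
  have h1 := cechMap_mem_cechB g (h _ (cechMap_cech_mem_cechGrading P f hf j e ψ) (by
    rw [← cechMap_cechD, ← P.cech_cechD, hψ, map_zero, map_zero]))
  rwa [← cechMap_comp, hgf, cechMap_id] at h1

/-- The way back from projections to subgroups. The family `𝒩` need not be known to be a grading, so
this applies directly to the tensor product. -/
theorem DegProj.Vanishes.localCohomologyGrading_eq_bot {P : DegProj K n M}
    {𝒩 : ℤ → AddSubgroup N} (f : N →ₗ[MvPolynomial (Fin n) K] M)
    (g : M →ₗ[MvPolynomial (Fin n) K] N) (hgf : g ∘ₗ f = LinearMap.id)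
    (h : ∀ d, ∀ x ∈ 𝒩 d, P.p d (f x) = f x) {j : ℕ} {e : ℤ}
    (hP : P.Vanishes j e) : localCohomologyGrading K n 𝒩 j e = ⊥ := by
  rw [localCohomologyGrading_eq_bot_iff]
  intro ψ hψ hd
  have h1 := hP (cechMap f j ψ) (by rw [← cechMap_cechD, hd, map_zero])
  rw [cech_cechMap_of_mem_cechGrading P f h hψ] at h1
  have h2 := cechMap_mem_cechB g h1
  rwa [← cechMap_comp, hgf, cechMap_id] at h2

end

/-! ### Local cohomology of the cokernel of a complex -/

section

variable {C : ℕ → Type v} [∀ i, AddCommGroup (C i)] [∀ i, Module (MvPolynomial (Fin n) K) (C i)]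

theorem DegProj.p_mem_range {M : Type v} [AddCommGroup M] [Module (MvPolynomial (Fin n) K) M]
    {N : Type w} [AddCommGroup N] [Module (MvPolynomial (Fin n) K) N]
    {P : DegProj K n M} {Q : DegProj K n N} {f : M →ₗ[MvPolynomial (Fin n) K] N}
    (h : ∀ d x, Q.p d (f x) = f (P.p d x)) (d : ℤ) (y : N) (hy : y ∈ LinearMap.range f) :
    Q.p d y ∈ LinearMap.range f := by
  obtain ⟨x, rfl⟩ := hy
  exact ⟨P.p d x, (h d x).symm⟩

theorem DegProj.p_mem_ker {M : Type v} [AddCommGroup M] [Module (MvPolynomial (Fin n) K) M]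
    {N : Type w} [AddCommGroup N] [Module (MvPolynomial (Fin n) K) N]
    {P : DegProj K n M} {Q : DegProj K n N} {f : M →ₗ[MvPolynomial (Fin n) K] N}
    (h : ∀ d x, Q.p d (f x) = f (P.p d x)) (d : ℤ) (y : M) (hy : y ∈ LinearMap.ker f) :
    P.p d y ∈ LinearMap.ker f := by
  rw [LinearMap.mem_ker] at hy ⊢
  rw [← h, hy, map_zero]

/-- With `B_i = im d_i` and `Z_i = ker d_i`, the sequences `0 → B_{i+1} → Z_i → H_{i+1} → 0` and `0
→ Z_i → C_{i+1} → B_i → 0` carry vanishing from `H^{j+i+2}(B_{i+1})` to `H^{j+i+1}(B_i)`. Finally `0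
→ B_0 → C_0 → coker → 0` is used. -/
theorem DegProj.vanishes_coker_of_complex (P : ∀ i, DegProj K n (C i))
    (d : ∀ i, C (i + 1) →ₗ[MvPolynomial (Fin n) K] C i)
    (hd : ∀ i e x, (P i).p e (d i x) = d i ((P (i + 1)).p e x))
    (hdd : ∀ i x, d i (d (i + 1) x) = 0) (j : ℕ) (e : ℤ)
    (hC : ∀ i, (P i).Vanishes (j + i) e)
    (hH : ∀ i, ((P (i + 1)).subquotient (LinearMap.ker (d i)) (LinearMap.range (d (i + 1)))
      (DegProj.p_mem_ker (hd i)) (DegProj.p_mem_range (hd (i + 1)))).Vanishes (j + i + 2) e) :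
    ((P 0).quotient (LinearMap.range (d 0)) (DegProj.p_mem_range (hd 0))).Vanishes j e := by
  -- Descending induction on `i`, with `k` bounding the distance to the range above `n`, where the
  -- Čech complex is zero. This is why the complex may be unbounded.
  have key : ∀ k i, n < j + i + 1 + k →
      ((P i).restrict (LinearMap.range (d i)) (DegProj.p_mem_range (hd i))).Vanishes
        (j + i + 1) e := by
    intro k
    induction k with
    | zero => exact fun i hi => DegProj.vanishes_of_lt _ (by omega) e
    | succ k ih =>
      intro i hi
      have hle : LinearMap.range (d (i + 1)) ≤ LinearMap.ker (d i) := by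
        rintro _ ⟨x, rfl⟩
        exact hdd i x
      have hZ : ((P (i + 1)).restrict (LinearMap.ker (d i))
          (DegProj.p_mem_ker (hd i))).Vanishes (j + i + 2) e := by
        refine DegProj.Vanishes.middle (f := Submodule.inclusion hle)
          (g := ((LinearMap.range (d (i + 1))).submoduleOf (LinearMap.ker (d i))).mkQ)
          (Submodule.inclusion_injective hle) (Submodule.mkQ_surjective _) ?_
          (fun _ _ => rfl) (fun _ _ => rfl) (ih (i + 1) (by omega)) (hH i)
        rw [LinearMap.exact_iff, Submodule.ker_mkQ, Submodule.range_inclusion]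
        rfl
      have hdi := hd i
      refine DegProj.Vanishes.right (f := (LinearMap.ker (d i)).subtype)
        (g := (d i).rangeRestrict) (Submodule.injective_subtype _)
        (LinearMap.surjective_rangeRestrict _) ?_ (fun _ _ => rfl)
        (fun e x => Subtype.ext (hd i e x)) (hC (i + 1)) hZ
      rw [LinearMap.exact_iff, LinearMap.ker_rangeRestrict, Submodule.range_subtype]
  refine DegProj.Vanishes.right (f := (LinearMap.range (d 0)).subtype)
    (g := (LinearMap.range (d 0)).mkQ) (Submodule.injective_subtype _)
    (Submodule.mkQ_surjective _) ?_ (fun _ _ => rfl) (fun _ _ => rfl) (hC 0)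
    (key n 0 (by omega))
  rw [LinearMap.exact_iff, Submodule.ker_mkQ, Submodule.range_subtype]

end

/-! ### Local cohomology of the polynomial ring -/

/-- The coefficient of a polynomial at an integral exponent vector. -/
def intCoeff (f : MvPolynomial (Fin n) K) (α : Fin n → ℤ) : K :=
  if ∀ i, 0 ≤ α i then f.coeff (Finsupp.equivFunOnFinite.symm fun i => (α i).toNat) else 0

theorem intCoeff_natCast (f : MvPolynomial (Fin n) K) (s : Fin n →₀ ℕ) :
    intCoeff f (fun i => (s i : ℤ)) = f.coeff s := by
  rw [intCoeff, if_pos fun i => by positivity]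
  congr 1
  ext i
  simp

theorem intCoeff_zero (α : Fin n → ℤ) : intCoeff (0 : MvPolynomial (Fin n) K) α = 0 := by
  simp [intCoeff]

theorem intCoeff_add (f g : MvPolynomial (Fin n) K) (α : Fin n → ℤ) :
    intCoeff (f + g) α = intCoeff f α + intCoeff g α := by
  rw [intCoeff, intCoeff, intCoeff]
  split_ifs <;> simp

theorem intCoeff_of_nonneg (f : MvPolynomial (Fin n) K) {α : Fin n → ℤ} (h : ∀ i, 0 ≤ α i) :
    ∃ s : Fin n →₀ ℕ, (∀ i, (s i : ℤ) = α i) ∧ intCoeff f α = f.coeff s := by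
  refine ⟨Finsupp.equivFunOnFinite.symm fun i => (α i).toNat, fun i => ?_, if_pos h⟩
  simpa using h i

theorem nonneg_of_intCoeff_ne_zero {f : MvPolynomial (Fin n) K} {α : Fin n → ℤ}
    (h : intCoeff f α ≠ 0) (i : Fin n) : 0 ≤ α i := by
  rw [intCoeff] at h
  by_contra h'
  exact h (if_neg fun h'' => h' (h'' i))

theorem intCoeff_monomial_mul (τ : Fin n →₀ ℕ) (f : MvPolynomial (Fin n) K) (α : Fin n → ℤ) :
    intCoeff (MvPolynomial.monomial τ 1 * f) (fun i => α i + τ i) = intCoeff f α := by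
  classical
  by_cases h : ∀ i, 0 ≤ α i
  · obtain ⟨s, hs, hs'⟩ := intCoeff_of_nonneg f h
    have : (fun i => α i + (τ i : ℤ)) = fun i => ((τ + s) i : ℤ) := by
      ext i
      rw [← hs i, Finsupp.add_apply]
      push_cast
      ring
    rw [hs', this, intCoeff_natCast, MvPolynomial.coeff_monomial_mul, one_mul]
  · rw [intCoeff, intCoeff, if_neg h]
    split_ifs with h'
    · rw [MvPolynomial.coeff_monomial_mul', if_neg]
      intro hle
      refine h fun i => ?_
      have h1 := hle i
      have h2 := h' i
      simp only [Finsupp.equivFunOnFinite_symm_apply_apply] at h1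
      omega
    · rfl

theorem exists_monomial_eq {S : Finset (Fin n)} (t : monomialsIn K n S) :
    ∃ τ : Fin n →₀ ℕ, (t : MvPolynomial (Fin n) K) = MvPolynomial.monomial τ 1 ∧
      ∀ i ∉ S, τ i = 0 := by
  obtain ⟨t, ht⟩ := t
  simp only
  induction ht using Submonoid.closure_induction with
  | mem x hx =>
    obtain ⟨i, hi, rfl⟩ := hx
    refine ⟨Finsupp.single i 1, rfl, fun k hk => ?_⟩
    rw [Finsupp.single_apply, if_neg]
    rintro rfl
    exact hk hi
  | one => exact ⟨0, rfl, fun _ _ => rfl⟩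
  | mul x y _ _ hx hy =>
    obtain ⟨τ, rfl, hτ⟩ := hx
    obtain ⟨σ, rfl, hσ⟩ := hy
    refine ⟨τ + σ, by rw [MvPolynomial.monomial_mul, mul_one], fun i hi => ?_⟩
    rw [Finsupp.add_apply, hτ i hi, hσ i hi]

theorem monomial_mem_monomialsIn {S : Finset (Fin n)} {τ : Fin n →₀ ℕ} (h : ∀ i ∉ S, τ i = 0) :
    (MvPolynomial.monomial τ 1 : MvPolynomial (Fin n) K) ∈ monomialsIn K n S := by
  rw [MvPolynomial.monomial_eq, map_one, one_mul]
  refine Submonoid.prod_mem _ fun i hi => Submonoid.pow_mem _ (Submonoid.subset_closure ?_) _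
  refine ⟨i, ?_, rfl⟩
  by_contra hiS
  exact Finsupp.mem_support_iff.mp hi (h i hiS)

/-- The exponent vector of a monomial. -/
def monExp {S : Finset (Fin n)} (t : monomialsIn K n S) : Fin n →₀ ℕ :=
  (exists_monomial_eq t).choose

theorem coe_eq_monomial_monExp {S : Finset (Fin n)} (t : monomialsIn K n S) :
    (t : MvPolynomial (Fin n) K) = MvPolynomial.monomial (monExp t) 1 :=
  (exists_monomial_eq t).choose_spec.1

theorem monExp_apply_eq_zero {S : Finset (Fin n)} (t : monomialsIn K n S) {i : Fin n}
    (hi : i ∉ S) : monExp t i = 0 :=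
  (exists_monomial_eq t).choose_spec.2 i hi

theorem monExp_eq {S : Finset (Fin n)} (t : monomialsIn K n S) {τ : Fin n →₀ ℕ}
    (h : (t : MvPolynomial (Fin n) K) = MvPolynomial.monomial τ 1) : monExp t = τ :=
  MvPolynomial.monomial_left_injective one_ne_zero ((coe_eq_monomial_monExp t).symm.trans h)

theorem monExp_mul {S : Finset (Fin n)} (t t' : monomialsIn K n S) :
    monExp (t * t') = monExp t + monExp t' :=
  monExp_eq _ (by rw [Submonoid.coe_mul, coe_eq_monomial_monExp, coe_eq_monomial_monExp t',
    MvPolynomial.monomial_mul, mul_one])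

theorem degree_monExp {S : Finset (Fin n)} (t : monomialsIn K n S) :
    (monExp t).degree = monDeg t :=
  eq_monDeg t (by
    rw [coe_eq_monomial_monExp]
    exact MvPolynomial.isHomogeneous_monomial 1 rfl)

theorem intCoeff_coe_mul {S : Finset (Fin n)} (t : monomialsIn K n S)
    (f : MvPolynomial (Fin n) K) (α : Fin n → ℤ) :
    intCoeff ((t : MvPolynomial (Fin n) K) * f) (fun i => α i + monExp t i) = intCoeff f α := by
  rw [coe_eq_monomial_monExp]
  exact intCoeff_monomial_mul _ _ _

/-! ### Laurent coefficients -/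

/-- The coefficient at `α` of an element of `R_{x_S}`, viewed as a Laurent polynomial. -/
def laurentCoeff (S : Finset (Fin n)) (α : Fin n → ℤ) :
    Loc K n (MvPolynomial (Fin n) K) S →+ K where
  toFun z := z.liftOn (fun q => intCoeff q.1 (fun i => α i + monExp q.2 i)) (by
    rintro ⟨x, t⟩ ⟨x', t'⟩ ⟨c, hc⟩
    simp only [Submonoid.smul_def, smul_eq_mul] at hc ⊢
    rw [← intCoeff_coe_mul t' x, ← intCoeff_coe_mul c, hc, ← intCoeff_coe_mul t x',
      ← intCoeff_coe_mul c (_ * x')]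
    congr 1
    ext i
    ring)
  map_zero' := by
    rw [← LocalizedModule.zero_mk 1, LocalizedModule.liftOn_mk, intCoeff_zero]
  map_add' z z' := by
    induction z, z' using LocalizedModule.induction_on₂ with
    | h x x' t t' =>
    simp only [LocalizedModule.mk_add_mk, LocalizedModule.liftOn_mk]
    rw [intCoeff_add, ← intCoeff_coe_mul t' x, ← intCoeff_coe_mul t x']
    simp only [monExp_mul, Finsupp.add_apply, Submonoid.smul_def, smul_eq_mul]
    congr 2 <;> · ext i; push_cast; ring

theorem laurentCoeff_mk {S : Finset (Fin n)} (α : Fin n → ℤ) (f : MvPolynomial (Fin n) K)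
    (t : monomialsIn K n S) :
    laurentCoeff S α (LocalizedModule.mk f t) = intCoeff f (fun i => α i + monExp t i) := rfl

theorem laurentCoeff_locMap {S T : Finset (Fin n)} (h : S ⊆ T) (α : Fin n → ℤ)
    (z : Loc K n (MvPolynomial (Fin n) K) S) :
    laurentCoeff T α (locMap K n _ h z) = laurentCoeff S α z := by
  induction z using LocalizedModule.induction_on with
  | h f t =>
    rw [locMap_mk, laurentCoeff_mk, laurentCoeff_mk,
      monExp_eq (⟨t.1, monomialsIn_mono K n h t.2⟩ : monomialsIn K n T) (coe_eq_monomial_monExp t)]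

theorem eq_zero_of_laurentCoeff {S : Finset (Fin n)} {z : Loc K n (MvPolynomial (Fin n) K) S}
    (h : ∀ α, laurentCoeff S α z = 0) : z = 0 := by
  induction z using LocalizedModule.induction_on with
  | h f t =>
    have hf : f = 0 := by
      ext s
      have := h fun i => s i - monExp t i
      rw [laurentCoeff_mk] at this
      simpa only [sub_add_cancel, intCoeff_natCast, MvPolynomial.coeff_zero] using this
    rw [hf, LocalizedModule.zero_mk]

theorem nonneg_of_laurentCoeff_ne_zero {S : Finset (Fin n)}
    {z : Loc K n (MvPolynomial (Fin n) K) S} {α : Fin n → ℤ} (h : laurentCoeff S α z ≠ 0)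
    {i : Fin n} (hi : i ∉ S) : 0 ≤ α i := by
  induction z using LocalizedModule.induction_on with
  | h f t =>
    rw [laurentCoeff_mk] at h
    have := nonneg_of_intCoeff_ne_zero h i
    rwa [monExp_apply_eq_zero t hi, Nat.cast_zero, add_zero] at this

theorem sum_eq_of_laurentCoeff_loc_ne_zero {S : Finset (Fin n)} {e : ℤ}
    {z : Loc K n (MvPolynomial (Fin n) K) S} {α : Fin n → ℤ}
    (h : laurentCoeff S α ((polyProj K n).loc S e z) ≠ 0) : ∑ i, α i = e := by
  induction z using LocalizedModule.induction_on with
  | h f t =>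
    rw [DegProj.loc_mk, laurentCoeff_mk] at h
    obtain ⟨s, hs, hs'⟩ := intCoeff_of_nonneg ((polyProj K n).p (monDeg t + e) f)
      fun i => nonneg_of_intCoeff_ne_zero h i
    rw [hs', coeff_polyProj] at h
    have h1 : (s.degree : ℤ) = monDeg t + e := by
      by_contra h'
      exact h (if_neg h')
    rw [← degree_monExp t, Finsupp.degree_eq_sum, Finsupp.degree_eq_sum] at h1
    push_cast at h1
    simp only [hs, Finset.sum_add_distrib] at h1
    linarith

theorem laurentCoeff_sgn_smul (S : Finset (Fin n)) (α : Fin n → ℤ) (k : Fin n)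
    (T : Finset (Fin n)) (z : Loc K n (MvPolynomial (Fin n) K) S) :
    laurentCoeff S α (sgn K k T • z) =
      MvPolynomial.constantCoeff (sgn K k T) * laurentCoeff S α z := by
  rcases neg_one_pow_eq_or (MvPolynomial (Fin n) K) (T.filter (fun i => i < k)).card with h | h <;>
    simp [sgn, h]

theorem exists_coeff_eq_ite (p : (Fin n →₀ ℕ) → Prop) [DecidablePred p]
    (f : MvPolynomial (Fin n) K) :
    ∃ g : MvPolynomial (Fin n) K, ∀ s, g.coeff s = if p s then f.coeff s else 0 := by
  classical
  refine ⟨∑ s ∈ f.support with p s, MvPolynomial.monomial s (f.coeff s), fun s => ?_⟩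
  simp only [MvPolynomial.coeff_sum, MvPolynomial.coeff_monomial, Finset.sum_ite_eq',
    Finset.mem_filter, MvPolynomial.mem_support_iff]
  by_cases h : f.coeff s = 0 <;> simp [h]

/-- Terms with nonnegative exponent at `i` need no power of `X_i` in the denominator, so the
selected part already lives over `S`. This makes the contracting homotopy available in the
localizations. -/
theorem exists_laurentCoeff_eq_ite {S : Finset (Fin n)} {i : Fin n}
    (p : (Fin n → ℤ) → Prop) [DecidablePred p] (hp : ∀ α, p α → 0 ≤ α i)
    (z : Loc K n (MvPolynomial (Fin n) K) (insert i S)) :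
    ∃ y : Loc K n (MvPolynomial (Fin n) K) S, ∀ α,
      laurentCoeff S α y = if p α then laurentCoeff (insert i S) α z else 0 := by
  classical
  induction z using LocalizedModule.induction_on with
  | h f t =>
    set τ := (monExp t).erase i with hτ
    have hτmem : ∀ k ∉ S, τ k = 0 := by
      intro k hk
      by_cases hki : k = i
      · rw [hτ, hki, Finsupp.erase_same]
      · rw [hτ, Finsupp.erase_ne hki]
        exact monExp_apply_eq_zero t (by simp [hki, hk])
    -- Division by the `X_i`-part of the denominator drops only terms with negative exponent at `i`,
    -- which `p` excludes anyway.
    obtain ⟨g, hg⟩ := exists_coeff_eq_ite (fun s => p fun k => (s k : ℤ) - τ k)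
      (f.divMonomial (Finsupp.single i (monExp t i)))
    have hexp : monExp (⟨MvPolynomial.monomial τ 1, monomial_mem_monomialsIn hτmem⟩ :
        monomialsIn K n S) = τ := monExp_eq _ rfl
    refine ⟨LocalizedModule.mk g ⟨MvPolynomial.monomial τ 1, monomial_mem_monomialsIn hτmem⟩,
      fun α => ?_⟩
    rw [laurentCoeff_mk, laurentCoeff_mk, hexp]
    by_cases h : ∀ k, 0 ≤ α k + τ k
    · obtain ⟨s, hs, hs'⟩ := intCoeff_of_nonneg g h
      rw [hs', hg]
      have h1 : (fun k => (s k : ℤ) - τ k) = α := by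
        ext k
        rw [hs k, add_sub_cancel_right]
      rw [h1, MvPolynomial.coeff_divMonomial, ← intCoeff_natCast]
      congr 2
      ext k
      rw [Finsupp.add_apply, Nat.cast_add, hs k, ← Finsupp.single_add_erase i (monExp t),
        Finsupp.add_apply, ← hτ]
      simp only [Finsupp.add_apply, Finsupp.single_eq_same]
      have h2 : τ i = 0 := by rw [hτ, Finsupp.erase_same]
      rw [h2, add_zero]
      push_cast
      ring
    · rw [intCoeff, if_neg h]
      split_ifs with hpα
      · rw [intCoeff, if_neg]
        intro h'
        refine h fun k => ?_
        by_cases hki : k = i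
        · have := hp α hpα
          rw [hki]
          positivity
        · rw [hτ, Finsupp.erase_ne hki]
          exact h' k
      · rfl

/-- The Čech complex splits by Laurent exponents `α`. If some `α_i ≥ 0`, inserting and deleting `i`
contracts the `α`-part. If all `α_i < 0`, only the full set of variables contributes, so `j = n` and
`e = ∑ α_i ≤ -n`, which is excluded. -/
theorem polyProj_vanishes {j : ℕ} {e : ℤ} (he : -(j : ℤ) < e) : (polyProj K n).Vanishes j e := by
  classical
  intro ψ₀ hψ₀
  set ψ := (polyProj K n).cech j e ψ₀ with hψdef
  have hψ : cechD K n _ j ψ = 0 := by rw [hψdef, ← DegProj.cech_cechD, hψ₀, map_zero]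
  let a : (Fin n → ℤ) → Finset (Fin n) → K := fun α S => laurentCoeff S α (cechCoeff ψ S S)
  let σ : Fin n → Finset (Fin n) → K := fun k T => MvPolynomial.constantCoeff (sgn K k T)
  have haT : ∀ α {S T : Finset (Fin n)}, S ⊆ T → laurentCoeff T α (cechCoeff ψ S T) = a α S :=
    fun α S T h => by
      rw [← locMap_cechCoeff ψ subset_rfl h, laurentCoeff_locMap]
  have hσ : ∀ {k l : Fin n} {T : Finset (Fin n)}, k ∈ T → l ∈ T → k ≠ l →
      σ k T * σ l (T.erase k) = -(σ l T * σ k (T.erase l)) := fun hk hl hkl => by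
    simpa using congrArg MvPolynomial.constantCoeff (sgn_mul_sgn_erase (K := K) hk hl hkl)
  have hσσ : ∀ k T, σ k T * σ k T = 1 := fun k T => by
    simpa using congrArg MvPolynomial.constantCoeff (sgn_mul_self (K := K) k T)
  have hcocycle : ∀ α (T : Finset (Fin n)), T.card = j + 1 →
      ∑ k ∈ T, σ k T * a α (T.erase k) = 0 := by
    intro α T hT
    have h := congrArg (laurentCoeff T α) (congrFun hψ ⟨T, hT⟩)
    rw [cechD_apply_eq_sum, map_sum, Pi.zero_apply, map_zero] at h
    rw [← h]
    refine Finset.sum_congr rfl fun k _ => ?_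
    rw [laurentCoeff_sgn_smul, haT α (Finset.erase_subset k T)]
  have hneg : ∀ α, (∀ i, α i < 0) → ∀ S, a α S = 0 := by
    intro α hα S
    by_contra h
    have hS : S = Finset.univ := by
      rw [Finset.eq_univ_iff_forall]
      intro i
      by_contra hi
      exact absurd (nonneg_of_laurentCoeff_ne_zero h hi) (not_le.mpr (hα i))
    have hc : S.card = j := by
      by_contra hc
      exact h (by simp only [a]; rw [cechCoeff, dif_neg fun h' => hc h'.1, map_zero])
    have h1 : ∑ i, α i = e := by
      refine sum_eq_of_laurentCoeff_loc_ne_zero (S := S) (z := ψ₀ ⟨S, hc⟩) ?_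
      have := cechCoeff_self ψ ⟨S, hc⟩
      simp only at this
      simp only [a] at h
      rw [this] at h
      exact h
    have h2 : ∑ i, α i ≤ ∑ _i : Fin n, (-1 : ℤ) :=
      Finset.sum_le_sum fun i _ => by have := hα i; omega
    rw [hS, Finset.card_univ, Fintype.card_fin] at hc
    simp at h2
    omega
  -- `i` is the first nonnegative index of `α`: a canonical choice of the contracting index, so that
  -- the homotopies for different `α` can be added up without overlap.
  let F : Fin n → (Fin n → ℤ) → Prop := fun i α => 0 ≤ α i ∧ ∀ k < i, α k < 0
  have hF : ∀ α, (∃ i, 0 ≤ α i) → ∃ i, F i α ∧ ∀ k, F k α → k = i := by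
    intro α hα
    obtain ⟨i, hi, hmin⟩ := WellFounded.has_min (wellFounded_lt (α := Fin n)) {i | 0 ≤ α i} hα
    refine ⟨i, ⟨hi, fun k hk => not_le.mp fun h => hmin k h hk⟩, fun k hk => ?_⟩
    rcases lt_trichotomy k i with h | h | h
    · exact absurd h (hmin k hk.1)
    · exact h
    · exact absurd (hk.2 i h) (not_lt.mpr hi)
  -- the key identity of the contracting homotopy
  have hkey : ∀ α i, F i α → ∀ T : Finset (Fin n), T.card = j →
      a α T = if i ∈ T then a α T else
        ∑ k ∈ T, σ k T * (σ i (insert i (T.erase k)) * a α (insert i (T.erase k))) := by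
    intro α i _ T hT
    split_ifs with hi
    · rfl
    -- The cocycle condition at `T ∪ {i}` is solved for the coefficient at `T`.
    have h := hcocycle α (insert i T) (by rw [Finset.card_insert_of_notMem hi, hT])
    rw [Finset.sum_insert hi, Finset.erase_insert hi] at h
    have h1 : ∑ k ∈ T, σ k T * (σ i (insert i (T.erase k)) * a α (insert i (T.erase k))) =
        -(σ i (insert i T)) * ∑ k ∈ T, σ k (insert i T) * a α ((insert i T).erase k) := by
      rw [Finset.mul_sum]
      refine Finset.sum_congr rfl fun k hk => ?_
      have hik : i ≠ k := fun h => hi (h ▸ hk)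
      rw [← Finset.erase_insert_of_ne hik]
      have h2 := hσ (Finset.mem_insert_self i T) (Finset.mem_insert_of_mem hk) hik
      rw [Finset.erase_insert hi] at h2
      have h3 := hσσ i (insert i T)
      have h4 := hσσ i ((insert i T).erase k)
      have h5 : σ k T = σ i (insert i T) * (σ i (insert i T) * σ k T) := by
        rw [← mul_assoc, h3, one_mul]
      rw [h5, h2]
      linear_combination (-σ i (insert i T) * σ k (insert i T) * a α ((insert i T).erase k)) * h4
    rw [h1, eq_neg_of_add_eq_zero_right h]
    linear_combination (-a α T) * hσσ i (insert i T)
  cases j with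
  | zero =>
    rw [cechB, Submodule.mem_bot]
    ext S
    refine eq_zero_of_laurentCoeff fun α => ?_
    rw [← cechCoeff_self ψ S]
    change a α S.1 = 0
    have hS : S.1 = ∅ := Finset.card_eq_zero.mp S.2
    by_cases hα : ∃ i, 0 ≤ α i
    · obtain ⟨i, hi, -⟩ := hF α hα
      rw [hkey α i hi S.1 S.2, hS]
      simp
    · exact hneg α (by simpa using hα) _
  | succ j =>
    -- `y S i` is the part of the component of `ψ` at `S ∪ {i}` on those exponents whose contracting
    -- index is `i`.
    choose y hy using fun (S : Finset (Fin n)) (i : Fin n) =>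
      exists_laurentCoeff_eq_ite (F i) (fun α h => h.1) (cechCoeff ψ (insert i S) (insert i S))
    let η : Cech K n (MvPolynomial (Fin n) K) j := fun S =>
      ∑ i ∈ S.1ᶜ, sgn K i (insert i S.1) • y S.1 i
    refine ⟨η, ?_⟩
    rw [← sub_eq_zero]
    ext T
    refine eq_zero_of_laurentCoeff fun α => ?_
    have hη : ∀ S : Finset (Fin n), S.card = j → laurentCoeff S α (cechCoeff η S S) =
        ∑ i ∈ Sᶜ, σ i (insert i S) * if F i α then a α (insert i S) else 0 := by
      intro S hS
      have := cechCoeff_self η ⟨S, hS⟩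
      simp only at this
      rw [this, map_sum]
      refine Finset.sum_congr rfl fun i _ => ?_
      rw [laurentCoeff_sgn_smul, hy]
    rw [Pi.sub_apply, map_sub, sub_eq_zero, cechD_apply_eq_sum, map_sum, ← cechCoeff_self ψ]
    change _ = a α T.1
    have hsum : ∀ k ∈ T.1, laurentCoeff T.1 α (sgn K k T.1 • cechCoeff η (T.1.erase k) T.1) =
        σ k T.1 * ∑ i ∈ (T.1.erase k)ᶜ, σ i (insert i (T.1.erase k)) *
          if F i α then a α (insert i (T.1.erase k)) else 0 := by
      intro k hk
      rw [laurentCoeff_sgn_smul, ← locMap_cechCoeff η subset_rfl (Finset.erase_subset k T.1),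
        laurentCoeff_locMap, hη _ (by rw [Finset.card_erase_of_mem hk, T.2]; rfl)]
    rw [Finset.sum_congr rfl hsum]
    by_cases hα : ∃ i, 0 ≤ α i
    · obtain ⟨i, hi, huniq⟩ := hF α hα
      have hinner : ∀ k ∈ T.1, (∑ l ∈ (T.1.erase k)ᶜ, σ l (insert l (T.1.erase k)) *
          if F l α then a α (insert l (T.1.erase k)) else 0) =
          if i ∈ (T.1.erase k)ᶜ then σ i (insert i (T.1.erase k)) *
            a α (insert i (T.1.erase k)) else 0 := by
        intro k _
        split_ifs with h
        · rw [Finset.sum_eq_single_of_mem i h, if_pos hi]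
          intro l _ hl
          rw [if_neg fun h' => hl (huniq l h'), mul_zero]
        · refine Finset.sum_eq_zero fun l hl => ?_
          rw [if_neg, mul_zero]
          intro h'
          exact h (huniq l h' ▸ hl)
      rw [Finset.sum_congr rfl fun k hk => by rw [hinner k hk]]
      -- If `i ∈ T`, only deleting `i` itself leaves a set to which `i` can be added again;
      -- otherwise every deletion contributes, and the sum is the one from the cocycle condition.
      by_cases hiT : i ∈ T.1
      · rw [Finset.sum_eq_single_of_mem i hiT, if_pos (by simp), Finset.insert_erase hiT,
          ← mul_assoc, hσσ, one_mul]
        intro k _ hk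
        rw [if_neg (by simp [hiT, Ne.symm hk]), mul_zero]
      · rw [hkey α i hi T.1 T.2, if_neg hiT]
        exact Finset.sum_congr rfl fun k _ => by rw [if_pos (by simp [hiT])]
    · have h0 := hneg α (by simpa using hα)
      simp [h0]

/-! ### The Koszul complex and the generators of a regular module -/

section

variable {M : Type v} [AddCommGroup M] [Module (MvPolynomial (Fin n) K) M]

variable (K M) in
/-- The Koszul differential on `M ⊗ ⋀ R^n`. -/
def koszulD : (Finset (Fin n) →₀ M) →ₗ[MvPolynomial (Fin n) K] (Finset (Fin n) →₀ M) :=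
  Finsupp.lsum (MvPolynomial (Fin n) K) fun T =>
    ∑ j ∈ T, (sgn K j T * MvPolynomial.X j) • Finsupp.lsingle (T.erase j)

theorem koszulD_single (T : Finset (Fin n)) (x : M) :
    koszulD K M (Finsupp.single T x) =
      ∑ j ∈ T, (sgn K j T * MvPolynomial.X j) • Finsupp.single (T.erase j) x := by
  simp [koszulD]

variable (K M) in
/-- The contracting homotopy for multiplication by `X_i` on the Koszul complex. -/
def koszulH (i : Fin n) :
    (Finset (Fin n) →₀ M) →ₗ[MvPolynomial (Fin n) K] (Finset (Fin n) →₀ M) :=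
  Finsupp.lsum (MvPolynomial (Fin n) K) fun T =>
    if i ∈ T then 0 else sgn K i (insert i T) • Finsupp.lsingle (insert i T)

theorem koszulH_single_of_mem {i : Fin n} {T : Finset (Fin n)} (h : i ∈ T) (x : M) :
    koszulH K M i (Finsupp.single T x) = 0 := by
  simp [koszulH, h]

theorem koszulH_single_of_notMem {i : Fin n} {T : Finset (Fin n)} (h : i ∉ T) (x : M) :
    koszulH K M i (Finsupp.single T x) = sgn K i (insert i T) • Finsupp.single (insert i T) x := by
  simp [koszulH, h]

theorem koszulD_koszulD (ψ : Finset (Fin n) →₀ M) : koszulD K M (koszulD K M ψ) = 0 := by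
  induction ψ using Finsupp.induction_linear with
  | zero => simp
  | add f g hf hg => rw [map_add, map_add, hf, hg, add_zero]
  | single T x =>
    rw [koszulD_single, map_sum]
    simp only [map_smul, koszulD_single, Finset.smul_sum, smul_smul]
    rw [Finset.sum_sigma']
    refine Finset.sum_involution (fun x _ => ⟨x.2, x.1⟩) ?_ ?_ ?_ ?_
    · rintro ⟨k, l⟩ h
      simp only [Finset.mem_sigma, Finset.mem_erase] at h
      simp only
      rw [Finset.erase_right_comm, ← add_smul]
      have := sgn_mul_sgn_erase (K := K) h.1 h.2.2 (Ne.symm h.2.1)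
      rw [show sgn K k T * MvPolynomial.X k * (sgn K l (T.erase k) * MvPolynomial.X l) +
        sgn K l T * MvPolynomial.X l * (sgn K k (T.erase l) * MvPolynomial.X k) = 0 by
        linear_combination (MvPolynomial.X k * MvPolynomial.X l) * this, zero_smul]
    · rintro ⟨k, l⟩ h _ h'
      simp only [Finset.mem_sigma, Finset.mem_erase] at h
      simp only [Sigma.mk.injEq, heq_eq_eq] at h'
      exact h.2.1 h'.1
    · rintro ⟨k, l⟩ h
      simp only [Finset.mem_sigma, Finset.mem_erase] at h ⊢
      exact ⟨h.2.2, Ne.symm h.2.1, h.1⟩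
    · rintro ⟨k, l⟩ _
      rfl

/-- Multiplication by `X_i` is null-homotopic, so every variable kills the Koszul homology. -/
theorem koszulD_koszulH_add (i : Fin n) (ψ : Finset (Fin n) →₀ M) :
    koszulD K M (koszulH K M i ψ) + koszulH K M i (koszulD K M ψ) =
      (MvPolynomial.X i : MvPolynomial (Fin n) K) • ψ := by
  induction ψ using Finsupp.induction_linear with
  | zero => simp
  | add f g hf hg =>
    rw [smul_add, ← hf, ← hg]
    simp only [map_add]
    abel
  | single T x =>
    rw [koszulD_single, map_sum]
    by_cases hi : i ∈ T
    · rw [koszulH_single_of_mem hi, map_zero, zero_add, Finset.sum_eq_single_of_mem i hi]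
      · rw [map_smul, koszulH_single_of_notMem (Finset.notMem_erase i T), Finset.insert_erase hi,
          smul_smul]
        congr 1
        linear_combination (MvPolynomial.X i) * sgn_mul_self (K := K) i T
      · intro k _ hk
        rw [map_smul, koszulH_single_of_mem (Finset.mem_erase.mpr ⟨Ne.symm hk, hi⟩), smul_zero]
    · rw [koszulH_single_of_notMem hi, map_smul, koszulD_single, Finset.sum_insert hi,
        Finset.erase_insert hi, smul_add, smul_smul, add_assoc, Finset.smul_sum,
        ← Finset.sum_add_distrib, Finset.sum_eq_zero, add_zero]
      · congr 1
        linear_combination (MvPolynomial.X i) * sgn_mul_self (K := K) i (insert i T)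
      · intro k hk
        have hik : i ≠ k := fun h => hi (h ▸ hk)
        rw [map_smul, koszulH_single_of_notMem (by simp [hi]), ← Finset.erase_insert_of_ne hik,
          smul_smul, smul_smul, ← add_smul]
        have h2 := sgn_mul_sgn_erase (K := K) (Finset.mem_insert_self i T)
          (Finset.mem_insert_of_mem hk) hik
        rw [Finset.erase_insert hi] at h2
        have h3 := sgn_mul_self (K := K) i (insert i T)
        have h4 := sgn_mul_self (K := K) i ((insert i T).erase k)
        rw [show sgn K i (insert i T) * (sgn K k (insert i T) * MvPolynomial.X k) +
          sgn K k T * MvPolynomial.X k * sgn K i ((insert i T).erase k) = 0 by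
          linear_combination (-MvPolynomial.X k * sgn K k T * sgn K i ((insert i T).erase k)) * h3 +
            (MvPolynomial.X k * sgn K i (insert i T) * sgn K i ((insert i T).erase k)) * h2 -
            (MvPolynomial.X k * sgn K i (insert i T) * sgn K k (insert i T)) * h4, zero_smul]

/-- Only the shift depends on the position `i`; the module is the sum over all subsets in every
position, so no bookkeeping of cardinalities is needed. -/
theorem koszulD_graded (P : DegProj K n M) (i : ℕ) (e : ℤ) (ψ : Finset (Fin n) →₀ M) :
    (P.finsupp fun _ => (i : ℤ)).p e (koszulD K M ψ) =
      koszulD K M ((P.finsupp fun _ => ((i + 1 : ℕ) : ℤ)).p e ψ) := by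
  induction ψ using Finsupp.induction_linear with
  | zero => simp
  | add f g hf hg => rw [map_add, map_add, hf, hg, map_add, map_add]
  | single T x =>
    rw [P.finsupp_single, koszulD_single, koszulD_single, map_sum]
    refine Finset.sum_congr rfl fun k _ => ?_
    rw [mul_smul, mul_smul, map_sgn_smul, Finsupp.smul_single, P.finsupp_single,
      Finsupp.smul_single, Finsupp.smul_single, Finsupp.smul_single,
      ← P.smul 1 _ _ _ (MvPolynomial.isHomogeneous_X K k)]
    congr 4
    push_cast
    ring

theorem mk_eq_zero_of_X_smul {S : Finset (Fin n)} {k : Fin n} (hk : k ∈ S) {x : M}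
    (hx : (MvPolynomial.X k : MvPolynomial (Fin n) K) • x = 0) (t : monomialsIn K n S) :
    LocalizedModule.mk x t = 0 := by
  rw [← LocalizedModule.zero_mk 1, LocalizedModule.mk_eq]
  exact ⟨⟨MvPolynomial.X k, Submonoid.subset_closure ⟨k, hk, rfl⟩⟩, by
    rw [smul_zero, smul_zero, one_smul]
    exact hx⟩

/-- A module killed by the variables becomes zero as soon as one variable is inverted, so its Čech
complex lives in position `0`. -/
theorem DegProj.vanishes_of_X_smul (P : DegProj K n M)
    (h : ∀ (k : Fin n) (x : M), (MvPolynomial.X k : MvPolynomial (Fin n) K) • x = 0)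
    (j : ℕ) (e : ℤ) : P.Vanishes (j + 1) e := by
  intro ψ _
  have : P.cech (j + 1) e ψ = 0 := by
    ext S
    obtain ⟨k, hk⟩ : S.1.Nonempty := Finset.card_pos.mp (by rw [S.2]; omega)
    rw [P.cech_apply, Pi.zero_apply]
    generalize ψ S = z
    induction z using LocalizedModule.induction_on with
    | h x t => rw [P.loc_mk, mk_eq_zero_of_X_smul hk (h k _)]
  rw [this]
  exact zero_mem _

/-- An element killed by all variables is a Čech `0`-cocycle, and there are no nonzero
`0`-coboundaries. -/
theorem DegProj.Vanishes.p_eq_zero {P : DegProj K n M} {e : ℤ} (hP : P.Vanishes 0 e) {x : M}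
    (hx : ∀ k : Fin n, (MvPolynomial.X k : MvPolynomial (Fin n) K) • x = 0) : P.p e x = 0 := by
  have hd : cechD K n M 0 (fun S => LocalizedModule.mk x 1) = 0 := by
    ext T
    rw [cechD_apply, Pi.zero_apply]
    refine Finset.sum_eq_zero fun k _ => ?_
    rw [locMap_mk, mk_eq_zero_of_X_smul k.2 (hx k.1), smul_zero]
  have h := congrFun ((Submodule.mem_bot _).mp (hP _ hd)) ⟨∅, rfl⟩
  rw [P.cech_apply, P.loc_mk, Pi.zero_apply, ← LocalizedModule.zero_mk 1, LocalizedModule.mk_eq] at h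
  obtain ⟨⟨c, hc⟩, h⟩ := h
  have hc1 : c = 1 := by simpa [monomialsIn] using hc
  subst hc1
  rw [monDeg_one] at h
  simpa [Submonoid.smul_def] using h

variable (K n M) in
/-- The map `M^n → M` given by the variables; its image is `R_+ M`. -/
def sumXSmul : (Fin n → M) →ₗ[MvPolynomial (Fin n) K] M :=
  ∑ k, (MvPolynomial.X k : MvPolynomial (Fin n) K) • LinearMap.proj k

theorem sumXSmul_apply (v : Fin n → M) :
    sumXSmul K n M v = ∑ k, (MvPolynomial.X k : MvPolynomial (Fin n) K) • v k := by
  simp [sumXSmul, LinearMap.sum_apply]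

theorem koszulD_apply_empty_mem (ψ : Finset (Fin n) →₀ M) :
    koszulD K M ψ ∅ ∈ LinearMap.range (sumXSmul K n M) := by
  induction ψ using Finsupp.induction_linear with
  | zero => simp
  | add f g hf hg =>
    rw [map_add, Finsupp.add_apply]
    exact add_mem hf hg
  | single T x =>
    rw [koszulD_single, Finsupp.finsetSum_apply]
    refine sum_mem fun k _ => ?_
    rw [mul_smul, Finsupp.smul_apply, Finsupp.smul_apply]
    refine Submodule.smul_mem _ _ ⟨Pi.single k (Finsupp.single (T.erase k) x ∅), ?_⟩
    rw [sumXSmul_apply, Finset.sum_eq_single k]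
    · rw [Pi.single_eq_same]
    · intro l _ hl
      rw [Pi.single_eq_of_ne hl, smul_zero]
    · exact fun h => absurd (Finset.mem_univ k) h

/-- If `H^j(M)_{e-j} = 0` for all `j`, then `M_e = R_1 M_{e-1}`. -/
theorem DegProj.exists_p_eq_sum_X_smul (P : DegProj K n M) (e : ℤ)
    (h : ∀ j : ℕ, P.Vanishes j (e - j)) (x : M) :
    ∃ v : Fin n → M, P.p e x =
      ∑ k, (MvPolynomial.X k : MvPolynomial (Fin n) K) • P.p (e - 1) (v k) := by
  -- The Koszul homology has no higher local cohomology, so `H^0` of the cokernel vanishes in degree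
  -- `e`. The class of `x` placed at `∅` is killed by the variables, hence its degree `e` part is a
  -- boundary, and the `∅`-component of a boundary lies in `R_+ M`.
  have key := DegProj.vanishes_coker_of_complex (C := fun _ => Finset (Fin n) →₀ M)
    (fun i => P.finsupp fun _ => (i : ℤ)) (fun _ => koszulD K M)
    (fun i e ψ => koszulD_graded P i e ψ) (fun _ => koszulD_koszulD (K := K)) 0 e
    (fun i => DegProj.Vanishes.finsupp fun _ => by rw [zero_add]; exact h i) (fun i => by
      refine DegProj.vanishes_of_X_smul _ (fun k x => ?_) _ _
      obtain ⟨⟨ψ, hψ⟩, rfl⟩ := Submodule.mkQ_surjective _ x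
      rw [← map_smul, Submodule.mkQ_apply, Submodule.Quotient.mk_eq_zero]
      refine ⟨koszulH K M k ψ, ?_⟩
      have h1 := koszulD_koszulH_add (K := K) k ψ
      rw [LinearMap.mem_ker.mp hψ, map_zero, add_zero] at h1
      exact h1)
  have h0 := key.p_eq_zero (x := (LinearMap.range (koszulD K M)).mkQ (Finsupp.single ∅ x))
    fun k => by
      rw [← map_smul, Submodule.mkQ_apply, Submodule.Quotient.mk_eq_zero]
      refine ⟨sgn K k {k} • Finsupp.single {k} x, ?_⟩
      rw [map_smul, koszulD_single, Finset.sum_singleton, smul_smul, ← mul_assoc, sgn_mul_self,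
        one_mul, Finset.erase_singleton]
  rw [DegProj.quotient_mkQ, Submodule.mkQ_apply, Submodule.Quotient.mk_eq_zero] at h0
  obtain ⟨ψ, hψ⟩ := h0
  obtain ⟨v, hv⟩ := koszulD_apply_empty_mem (K := K) ψ
  refine ⟨v, ?_⟩
  rw [hψ, P.finsupp_single, Finsupp.single_eq_same] at hv
  rw [Nat.cast_zero, sub_zero] at hv
  rw [← P.idem e x, ← hv, sumXSmul_apply, map_sum]
  refine Finset.sum_congr rfl fun k _ => ?_
  rw [← P.smul 1 _ _ _ (MvPolynomial.isHomogeneous_X K k)]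
  congr 2
  push_cast
  ring

/-! ### Generators and syzygies of regular modules -/

/-- `μ`-regularity. -/
def DegProj.Regular (P : DegProj K n M) (μ : ℤ) : Prop :=
  ∀ (j : ℕ) (e : ℤ), μ - j < e → P.Vanishes j e

/-- Above degree `μ` each graded piece is `R_1` times the preceding one, so the elements of degree
at most `μ` generate the module. -/
theorem DegProj.Regular.eq_top {P : DegProj K n M} {μ : ℤ} (hP : P.Regular μ) (hT : P.Total)
    {W : Submodule (MvPolynomial (Fin n) K) M} (hW : ∀ d ≤ μ, ∀ x, P.p d x ∈ W) : W = ⊤ := by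
  have key : ∀ (k : ℕ) (d : ℤ), d ≤ μ + k → ∀ x, P.p d x ∈ W := by
    intro k
    induction k with
    | zero => exact fun d hd x => hW d (by simpa using hd) x
    | succ k ih =>
      intro d hd x
      by_cases hd' : d ≤ μ
      · exact hW d hd' x
      obtain ⟨v, hv⟩ := P.exists_p_eq_sum_X_smul d (fun j => hP j _ (by omega)) x
      rw [hv]
      exact sum_mem fun l _ => W.smul_mem _ (ih (d - 1) (by push_cast at hd; omega) _)
  rw [eq_top_iff]
  intro x _
  obtain ⟨s, hs⟩ := hT x
  rw [hs s subset_rfl]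
  exact sum_mem fun d _ => key (d - μ).toNat d (by omega) x

theorem DegProj.Regular.finsupp_polyProj {ι : Type w} {deg : ι → ℤ} {μ : ℤ}
    (h : ∀ b, deg b ≤ μ) : ((polyProj K n).finsupp deg).Regular μ :=
  fun j e he => DegProj.Vanishes.finsupp fun b => polyProj_vanishes (by have := h b; omega)

/-- `H^{j+1}` of the kernel sits between `H^j(M)` and `H^{j+1}` of the free module. The index shift
by one is what raises the regularity to `μ + 1`. -/
theorem DegProj.Regular.ker {P : DegProj K n M} {μ : ℤ} (hP : P.Regular μ) {ι : Type w}
    {deg : ι → ℤ} (hdeg : ∀ b, deg b ≤ μ)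
    (φ : (ι →₀ MvPolynomial (Fin n) K) →ₗ[MvPolynomial (Fin n) K] M)
    (hφ : ∀ d x, P.p d (φ x) = φ (((polyProj K n).finsupp deg).p d x))
    (hsurj : Function.Surjective φ) :
    (((polyProj K n).finsupp deg).restrict (LinearMap.ker φ) (DegProj.p_mem_ker hφ)).Regular
      (μ + 1) := by
  intro j e he
  have hfree := DegProj.Regular.finsupp_polyProj (K := K) (n := n) hdeg j e (by omega)
  cases j with
  | zero =>
    exact DegProj.Vanishes.zero_left (f := (LinearMap.ker φ).subtype)
      (Submodule.injective_subtype _) (fun _ _ => rfl) hfree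
  | succ j =>
    refine DegProj.Vanishes.left (f := (LinearMap.ker φ).subtype) (g := φ)
      (Submodule.injective_subtype _) hsurj ?_ (fun _ _ => rfl) hφ
      (hP j e (by push_cast at he; omega)) hfree
    rw [LinearMap.exact_iff, Submodule.range_subtype]

end

/-! ### Linear maps of degree zero out of free modules -/

section

variable {M : Type v} [AddCommGroup M] [Module (MvPolynomial (Fin n) K) M]

theorem DegProj.p_smul (P : DegProj K n M) {c : ℤ} {v : M} (hv : P.p c v = v) (e : ℤ)
    (f : MvPolynomial (Fin n) K) : P.p e (f • v) = (polyProj K n).p (e - c) f • v := by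
  obtain ⟨s, hs⟩ := polyProj_total f
  have hterm : ∀ d, P.p e ((polyProj K n).p d f • v) =
      if d = e - c then (polyProj K n).p d f • v else 0 := by
    intro d
    rcases lt_or_ge d 0 with hd | hd
    · simp [polyProj_p_of_neg hd]
    · lift d to ℕ using hd
      have h := P.smul d (e - d) _ v (isHomogeneous_iff_polyProj.mpr ((polyProj K n).idem d f))
      rw [add_sub_cancel] at h
      rw [h]
      split_ifs with hdc
      · rw [show e - d = c by omega, hv]
      · rw [← hv, P.orth _ _ _ (by omega), smul_zero]
  -- Enlarging the index set makes the only surviving term occur in it, even if that component of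
  -- `f` is zero.
  have h1 := hs (insert (e - c) s) (Finset.subset_insert _ _)
  conv_lhs => rw [h1, Finset.sum_smul, map_sum]
  simp only [hterm, Finset.sum_ite_eq', Finset.mem_insert_self, if_true]

theorem linearCombination_graded (P : DegProj K n M) {ι : Type w} {deg : ι → ℤ} {v : ι → M}
    (hv : ∀ b, P.p (deg b) (v b) = v b) (e : ℤ) (x : ι →₀ MvPolynomial (Fin n) K) :
    P.p e (Finsupp.linearCombination (MvPolynomial (Fin n) K) v x) =
      Finsupp.linearCombination (MvPolynomial (Fin n) K) v
        (((polyProj K n).finsupp deg).p e x) := by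
  induction x using Finsupp.induction_linear with
  | zero => simp
  | add f g hf hg => simp only [map_add, hf, hg]
  | single b f =>
    rw [DegProj.finsupp_single, Finsupp.linearCombination_single, Finsupp.linearCombination_single,
      P.p_smul (hv b)]

theorem finsupp_p_single_one {ι : Type w} (deg : ι → ℤ) (b : ι) :
    ((polyProj K n).finsupp deg).p (deg b) (Finsupp.single b 1) = Finsupp.single b 1 := by
  rw [DegProj.finsupp_single, sub_self,
    show (0 : ℤ) = ((0 : ℕ) : ℤ) from rfl,
    isHomogeneous_iff_polyProj.mp (MvPolynomial.isHomogeneous_one (Fin n) K)]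

end

/-! ### The part of the standard resolution in bounded degrees -/

section

variable {M : Type v} [AddCommGroup M] [Module (MvPolynomial (Fin n) K) M]

/-- The grading of the standard free modules. -/
def stdProj (ℳ : ℤ → AddSubgroup M) (k : ℕ) : DegProj K n (StdFree K n ℳ k) :=
  (polyProj K n).finsupp (stdResolution K n ℳ k).deg

/-- The generators of the standard resolution that have degree at most `m + k` in step `k`, and
whose boundaries involve only such generators. -/
def keep (K : Type u) [Field K] (n : ℕ) {M : Type v} [AddCommGroup M]
    [Module (MvPolynomial (Fin n) K) M] (ℳ : ℤ → AddSubgroup M) (m : ℤ) :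
    (k : ℕ) → Set (stdResolution K n ℳ k).ι
  | 0 => {b | (stdResolution K n ℳ 0).deg b ≤ m}
  | k + 1 => {b : (stdResolution K n ℳ k).Gen |
      b.1.1 ≤ m + k + 1 ∧ ∀ c ∉ keep K n ℳ m k, b.1.2 c = 0}

/-- The free modules of the bounded resolution. -/
abbrev KeepFree (K : Type u) [Field K] (n : ℕ) {M : Type v} [AddCommGroup M]
    [Module (MvPolynomial (Fin n) K) M] (ℳ : ℤ → AddSubgroup M) (m : ℤ) (k : ℕ) :
    Type (max u v) :=
  keep K n ℳ m k →₀ MvPolynomial (Fin n) K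

variable (ℳ : ℤ → AddSubgroup M) (m : ℤ)

/-- The degrees of the generators of the bounded resolution. -/
def keepDeg (k : ℕ) (b : keep K n ℳ m k) : ℤ := (stdResolution K n ℳ k).deg b.1

theorem keepDeg_le (k : ℕ) (b : keep K n ℳ m k) : keepDeg ℳ m k b ≤ m + k := by
  cases k with
  | zero =>
    have h : keepDeg ℳ m 0 b ≤ m := b.2
    simpa using h
  | succ k =>
    have h := b.2.1
    push_cast
    rw [← add_assoc]
    exact h

/-- The grading of the free modules of the bounded resolution. -/
def keepProj (k : ℕ) : DegProj K n (KeepFree K n ℳ m k) :=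
  (polyProj K n).finsupp (keepDeg ℳ m k)

/-- The inclusion of the bounded resolution. -/
def keepIncl (k : ℕ) : KeepFree K n ℳ m k →ₗ[MvPolynomial (Fin n) K] StdFree K n ℳ k :=
  Finsupp.lmapDomain (MvPolynomial (Fin n) K) (MvPolynomial (Fin n) K) Subtype.val

theorem keepIncl_single (k : ℕ) (b : keep K n ℳ m k) (f : MvPolynomial (Fin n) K) :
    keepIncl ℳ m k (Finsupp.single b f) = Finsupp.single b.1 f := by
  simp [keepIncl]

theorem keepIncl_injective (k : ℕ) : Function.Injective (keepIncl (K := K) (n := n) ℳ m k) :=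
  Finsupp.mapDomain_injective Subtype.val_injective

theorem keepIncl_apply_of_notMem (k : ℕ) (x : KeepFree K n ℳ m k) {c : (stdResolution K n ℳ k).ι}
    (hc : c ∉ keep K n ℳ m k) : keepIncl ℳ m k x c = 0 :=
  Finsupp.mapDomain_of_notMem_range x c (by simpa using hc)

theorem keepIncl_graded (k : ℕ) (e : ℤ) (x : KeepFree K n ℳ m k) :
    (stdProj ℳ k).p e (keepIncl ℳ m k x) = keepIncl ℳ m k ((keepProj ℳ m k).p e x) := by
  induction x using Finsupp.induction_linear with
  | zero => simp
  | add f g hf hg => simp only [map_add, hf, hg]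
  | single b f =>
    rw [keepIncl_single, stdProj, keepProj, DegProj.finsupp_single, DegProj.finsupp_single,
      keepIncl_single]
    rfl

/-- The element of the standard resolution that is supported in the bounded part, as an element
of the bounded resolution. -/
def keepRestr (k : ℕ) : StdFree K n ℳ k →ₗ[MvPolynomial (Fin n) K] KeepFree K n ℳ m k :=
  Finsupp.lcomapDomain Subtype.val Subtype.val_injective

theorem keepIncl_keepRestr (k : ℕ) {x : StdFree K n ℳ k}
    (hx : ∀ c ∉ keep K n ℳ m k, x c = 0) : keepIncl ℳ m k (keepRestr ℳ m k x) = x := by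
  ext1 c
  by_cases hc : c ∈ keep K n ℳ m k
  · exact (Finsupp.mapDomain_apply Subtype.val_injective _ (⟨c, hc⟩ : keep K n ℳ m k)).trans rfl
  · rw [keepIncl_apply_of_notMem ℳ m k _ hc, hx c hc]

/-- The differential of the bounded resolution. -/
def keepD (k : ℕ) :
    KeepFree K n ℳ m (k + 1) →ₗ[MvPolynomial (Fin n) K] KeepFree K n ℳ m k :=
  keepRestr ℳ m k ∘ₗ stdD K n ℳ k ∘ₗ keepIncl ℳ m (k + 1)

theorem stdD_single (k : ℕ) (b : (stdResolution K n ℳ k).Gen) (f : MvPolynomial (Fin n) K) :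
    stdD K n ℳ k (Finsupp.single b f : (stdResolution K n ℳ k).Gen →₀ _) = f • b.1.2 :=
  Finsupp.linearCombination_single _ _ _

theorem keepIncl_keepD (k : ℕ) (x : KeepFree K n ℳ m (k + 1)) :
    keepIncl ℳ m k (keepD ℳ m k x) = stdD K n ℳ k (keepIncl ℳ m (k + 1) x) := by
  refine keepIncl_keepRestr ℳ m k fun c hc => ?_
  induction x using Finsupp.induction_linear with
  | zero => simp
  | add f g hf hg => rw [map_add, Finsupp.add_apply, hf, hg, add_zero]
  | single b f =>
    rw [LinearMap.comp_apply, keepIncl_single]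
    rw [show stdD K n ℳ k (Finsupp.single b.1 f) = _ from stdD_single ℳ k b.1 f,
      Finsupp.smul_apply, b.2.2 c hc, smul_zero]

theorem stdD_graded (k : ℕ) (e : ℤ) (x : StdFree K n ℳ (k + 1)) :
    (stdProj ℳ k).p e (stdD K n ℳ k x) = stdD K n ℳ k ((stdProj ℳ (k + 1)).p e x) :=
  linearCombination_graded (stdProj ℳ k) (deg := (stdResolution K n ℳ (k + 1)).deg)
    (fun b : (stdResolution K n ℳ k).Gen => (mem_freeGrading_iff _ _ _).mp b.2.2) e x

theorem keepD_graded (k : ℕ) (e : ℤ) (x : KeepFree K n ℳ m (k + 1)) :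
    (keepProj ℳ m k).p e (keepD ℳ m k x) = keepD ℳ m k ((keepProj ℳ m (k + 1)).p e x) := by
  apply keepIncl_injective
  rw [← keepIncl_graded, keepIncl_keepD, keepIncl_keepD, stdD_graded, keepIncl_graded]

variable (K n) in
/-- The augmentation of the standard resolution. -/
def stdAug : StdFree K n ℳ 0 →ₗ[MvPolynomial (Fin n) K] M :=
  Finsupp.linearCombination (MvPolynomial (Fin n) K)
    fun b : ULift.{u} (Σ d : ℤ, ℳ d) => (b.down.2 : M)

/-- The cycles of the bounded resolution. -/
def keepCycles (k : ℕ) : Submodule (MvPolynomial (Fin n) K) (KeepFree K n ℳ m k) :=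
  (stdResolution K n ℳ k).cycles.comap (keepIncl ℳ m k)

theorem keepCycles_zero :
    keepCycles ℳ m 0 = LinearMap.ker (stdAug K n ℳ ∘ₗ keepIncl ℳ m 0) := rfl

theorem ker_keepD (k : ℕ) :
    LinearMap.ker (keepD (K := K) (n := n) ℳ m k) = keepCycles ℳ m (k + 1) := by
  ext x
  rw [LinearMap.mem_ker, ← map_eq_zero_iff _ (keepIncl_injective ℳ m k), keepIncl_keepD]
  rfl

theorem stdD_mem_cycles (k : ℕ) (x : StdFree K n ℳ (k + 1)) :
    stdD K n ℳ k x ∈ (stdResolution K n ℳ k).cycles := by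
  induction x using Finsupp.induction_linear with
  | zero => rw [map_zero]; exact zero_mem _
  | add f g hf hg => rw [map_add]; exact add_mem hf hg
  | single b f =>
    rw [show stdD K n ℳ k (Finsupp.single b f) = _ from stdD_single ℳ k b f]
    exact Submodule.smul_mem _ _ b.2.1

theorem keepD_mem_keepCycles (k : ℕ) (x : KeepFree K n ℳ m (k + 1)) :
    keepD ℳ m k x ∈ keepCycles ℳ m k := by
  rw [keepCycles, Submodule.mem_comap, keepIncl_keepD]
  exact stdD_mem_cycles ℳ k _

/-- Such a cycle is itself the label of a kept generator, and that generator maps to it. -/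
theorem mem_range_keepD (k : ℕ) {d : ℤ} (hd : d ≤ m + k + 1) {x : KeepFree K n ℳ m k}
    (hx : x ∈ keepCycles ℳ m k) (hxd : (keepProj ℳ m k).p d x = x) :
    x ∈ LinearMap.range (keepD ℳ m k) := by
  let b : (stdResolution K n ℳ k).Gen := ⟨(d, keepIncl ℳ m k x), hx, by
    rw [mem_freeGrading_iff]
    exact (keepIncl_graded ℳ m k d x).trans (by rw [hxd])⟩
  have hb : b ∈ keep K n ℳ m (k + 1) :=
    ⟨hd, fun c hc => keepIncl_apply_of_notMem ℳ m k x hc⟩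
  refine ⟨Finsupp.single ⟨b, hb⟩ 1, ?_⟩
  apply keepIncl_injective
  rw [keepIncl_keepD, keepIncl_single, show stdD K n ℳ k (Finsupp.single b 1) = _ from
    stdD_single ℳ k b 1, one_smul]

end

/-! ### The bounded resolution of a regular module -/

section

variable {M : Type v} [AddCommGroup M] [Module (MvPolynomial (Fin n) K) M]
  {ℳ : ℤ → AddSubgroup M} {m : ℤ}

theorem DegProj.Regular.restrict_congr {P : DegProj K n M}
    {Z Z' : Submodule (MvPolynomial (Fin n) K) M} (h : Z = Z')
    {hZ : ∀ d, ∀ x ∈ Z, P.p d x ∈ Z} {μ : ℤ} (hP : (P.restrict Z hZ).Regular μ)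
    (hZ' : ∀ d, ∀ x ∈ Z', P.p d x ∈ Z') : (P.restrict Z' hZ').Regular μ := by
  subst h
  exact hP

theorem stdAug_graded {P : DegProj K n M} (hP : ∀ d, ∀ x ∈ ℳ d, P.p d x = x) (e : ℤ)
    (x : StdFree K n ℳ 0) : P.p e (stdAug K n ℳ x) = stdAug K n ℳ ((stdProj ℳ 0).p e x) :=
  linearCombination_graded P (deg := (stdResolution K n ℳ 0).deg)
    (fun b : ULift.{u} (Σ d : ℤ, ℳ d) => hP _ _ b.down.2.2) e x

theorem keepAug_graded {P : DegProj K n M} (hP : ∀ d, ∀ x ∈ ℳ d, P.p d x = x) (e : ℤ)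
    (x : KeepFree K n ℳ m 0) : P.p e ((stdAug K n ℳ ∘ₗ keepIncl ℳ m 0) x) =
      (stdAug K n ℳ ∘ₗ keepIncl ℳ m 0) ((keepProj ℳ m 0).p e x) := by
  rw [LinearMap.comp_apply, stdAug_graded hP, keepIncl_graded]
  rfl

theorem p_mem_keepCycles {P : DegProj K n M} (hP : ∀ d, ∀ x ∈ ℳ d, P.p d x = x) (k : ℕ) (d : ℤ)
    (x : KeepFree K n ℳ m k) (hx : x ∈ keepCycles ℳ m k) :
    (keepProj ℳ m k).p d x ∈ keepCycles ℳ m k := by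
  cases k with
  | zero =>
    rw [keepCycles_zero] at hx ⊢
    exact DegProj.p_mem_ker (keepAug_graded hP) d x hx
  | succ k =>
    rw [← ker_keepD] at hx ⊢
    exact DegProj.p_mem_ker (keepD_graded ℳ m k) d x hx

theorem keepAug_surjective {P : DegProj K n M} (hPT : P.Total) (hPmem : ∀ d x, P.p d x ∈ ℳ d)
    (hreg : P.Regular m) :
    Function.Surjective (stdAug K n ℳ ∘ₗ keepIncl ℳ m 0) := by
  rw [← LinearMap.range_eq_top]
  refine hreg.eq_top hPT fun d hd x => ?_
  let b : (stdResolution K n ℳ 0).ι := ULift.up ⟨d, ⟨P.p d x, hPmem d x⟩⟩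
  have hb : b ∈ keep K n ℳ m 0 := hd
  refine ⟨Finsupp.single ⟨b, hb⟩ 1, ?_⟩
  rw [LinearMap.comp_apply, keepIncl_single]
  exact (Finsupp.linearCombination_single _ _ _).trans (one_smul _ _)

theorem keepProj_total (k : ℕ) : (keepProj (K := K) (n := n) ℳ m k).Total :=
  polyProj_total.finsupp _

/-- Regularity says that the cycles are generated in degrees at most `m + k + 1`, and homogeneous
cycles of those degrees are boundaries by construction. -/
theorem range_keepD_of_regular {P : DegProj K n M} (hP : ∀ d, ∀ x ∈ ℳ d, P.p d x = x) {k : ℕ}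
    (hreg : ((keepProj ℳ m k).restrict (keepCycles ℳ m k) (p_mem_keepCycles hP k)).Regular
      (m + k + 1)) : LinearMap.range (keepD (K := K) (n := n) ℳ m k) = keepCycles ℳ m k := by
  apply le_antisymm
  · rintro _ ⟨x, rfl⟩
    exact keepD_mem_keepCycles ℳ m k x
  · intro x hx
    have h := hreg.eq_top ((keepProj_total k).restrict _ _)
      (W := (LinearMap.range (keepD ℳ m k)).comap (keepCycles ℳ m k).subtype) fun d hd y =>
        mem_range_keepD ℳ m k hd (p_mem_keepCycles hP k d y.1 y.2) ((keepProj ℳ m k).idem d y.1)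
    have hx' : (⟨x, hx⟩ : keepCycles ℳ m k) ∈
        (⊤ : Submodule (MvPolynomial (Fin n) K) (keepCycles ℳ m k)) := trivial
    rw [← h] at hx'
    exact hx'

/-- Regularity and exactness are established together: regularity of one cycle module makes the next
free module surject onto it, and the kernel is again regular with bound raised by one. -/
theorem keepCycles_regular {P : DegProj K n M} (hP : ∀ d, ∀ x ∈ ℳ d, P.p d x = x)
    (hPT : P.Total) (hPmem : ∀ d x, P.p d x ∈ ℳ d) (hreg : P.Regular m) (k : ℕ) :
    ((keepProj ℳ m k).restrict (keepCycles ℳ m k) (p_mem_keepCycles hP k)).Regular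
      (m + k + 1) := by
  induction k with
  | zero =>
    have h := hreg.ker (fun b => by simpa using keepDeg_le (K := K) (n := n) ℳ m 0 b)
      (stdAug K n ℳ ∘ₗ keepIncl ℳ m 0) (keepAug_graded hP) (keepAug_surjective hPT hPmem hreg)
    rw [Nat.cast_zero, add_zero]
    exact h
  | succ k ih =>
    let φ := (keepD (K := K) (n := n) ℳ m k).codRestrict (keepCycles ℳ m k) (keepD_mem_keepCycles ℳ m k)
    have hφ : Function.Surjective φ := by
      rintro ⟨x, hx⟩
      rw [← range_keepD_of_regular hP ih] at hx
      obtain ⟨y, rfl⟩ := hx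
      exact ⟨y, rfl⟩
    have h := ih.ker (deg := keepDeg ℳ m (k + 1))
      (fun b => by have := keepDeg_le (K := K) (n := n) ℳ m (k + 1) b; push_cast at this; omega) φ
      (fun d x => Subtype.ext (keepD_graded ℳ m k d x)) hφ
    have hker : LinearMap.ker φ = keepCycles ℳ m (k + 1) := by
      rw [LinearMap.ker_codRestrict, ker_keepD]
    have h2 := DegProj.Regular.restrict_congr hker h (p_mem_keepCycles hP (k + 1))
    push_cast
    rw [← add_assoc m]
    exact h2

/-- The standard resolution retracts to its bounded part. -/
theorem exists_keep_retraction {P : DegProj K n M} (hP : ∀ d, ∀ x ∈ ℳ d, P.p d x = x)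
    (hPT : P.Total) (hPmem : ∀ d x, P.p d x ∈ ℳ d) (hreg : P.Regular m) :
    ∃ r : ∀ k, StdFree K n ℳ k →ₗ[MvPolynomial (Fin n) K] KeepFree K n ℳ m k,
      (∀ k, r k ∘ₗ keepIncl ℳ m k = LinearMap.id) ∧
        ∀ k, keepD ℳ m k ∘ₗ r (k + 1) = r k ∘ₗ stdD K n ℳ k := by
  -- Preservation of cycles is carried along the recursion, because the next step must lift images
  -- of boundaries through the bounded differential.
  let Good : ℕ → Type (max u v) := fun k =>
    {r : StdFree K n ℳ k →ₗ[MvPolynomial (Fin n) K] KeepFree K n ℳ m k //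
      r ∘ₗ keepIncl ℳ m k = LinearMap.id ∧
        ∀ x ∈ (stdResolution K n ℳ k).cycles, r x ∈ keepCycles ℳ m k}
  have hsurj := keepAug_surjective (K := K) hPT hPmem hreg
  have h0 : ∃ r : StdFree K n ℳ 0 →ₗ[MvPolynomial (Fin n) K] KeepFree K n ℳ m 0,
      r ∘ₗ keepIncl ℳ m 0 = LinearMap.id ∧
        (stdAug K n ℳ ∘ₗ keepIncl ℳ m 0) ∘ₗ r = stdAug K n ℳ := by
    classical
    have : ∀ b : (stdResolution K n ℳ 0).ι, ∃ y : KeepFree K n ℳ m 0,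
        (∀ h : b ∈ keep K n ℳ m 0, y = Finsupp.single ⟨b, h⟩ 1) ∧
          (stdAug K n ℳ ∘ₗ keepIncl ℳ m 0) y = stdAug K n ℳ (Finsupp.single b 1) := by
      intro b
      by_cases h : b ∈ keep K n ℳ m 0
      · exact ⟨_, fun _ => rfl, by rw [LinearMap.comp_apply, keepIncl_single (b := ⟨b, h⟩)]⟩
      · obtain ⟨y, hy⟩ := hsurj (stdAug K n ℳ (Finsupp.single b 1))
        exact ⟨y, fun h' => absurd h' h, hy⟩
    choose y hy hy' using this
    refine ⟨Finsupp.linearCombination _ y, ?_, ?_⟩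
    · refine Finsupp.lhom_ext' fun b => LinearMap.ext_ring ?_
      simp only [LinearMap.comp_apply, Finsupp.lsingle_apply, keepIncl_single,
        Finsupp.linearCombination_single, one_smul, LinearMap.id_apply]
      exact hy b.1 b.2
    · refine Finsupp.lhom_ext' fun b => LinearMap.ext_ring ?_
      rw [LinearMap.comp_apply, LinearMap.comp_apply, Finsupp.lsingle_apply,
        Finsupp.linearCombination_single, one_smul, hy']
      rfl
  have hstep : ∀ k (r : Good k), ∃ r' : Good (k + 1), keepD ℳ m k ∘ₗ r'.1 = r.1 ∘ₗ stdD K n ℳ k := by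
    classical
    rintro k ⟨r, hr, hrc⟩
    have hrange := range_keepD_of_regular hP (keepCycles_regular hP hPT hPmem hreg k)
    have : ∀ b : (stdResolution K n ℳ (k + 1)).ι, ∃ y : KeepFree K n ℳ m (k + 1),
        (∀ h : b ∈ keep K n ℳ m (k + 1), y = Finsupp.single ⟨b, h⟩ 1) ∧
          keepD ℳ m k y = r (stdD K n ℳ k (Finsupp.single b 1)) := by
      intro b
      -- Kept generators must go to themselves; any other generator goes to an arbitrary lift, which
      -- exactness provides.
      by_cases h : b ∈ keep K n ℳ m (k + 1)
      · refine ⟨Finsupp.single ⟨b, h⟩ 1, fun _ => rfl, ?_⟩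
        rw [← keepIncl_single ℳ m (k + 1) ⟨b, h⟩, ← keepIncl_keepD]
        exact (LinearMap.congr_fun hr _).symm
      · have hmem := hrc _ (stdD_mem_cycles ℳ k (Finsupp.single b 1))
        rw [← hrange] at hmem
        obtain ⟨y, hy⟩ := hmem
        exact ⟨y, fun h' => absurd h' h, hy⟩
    choose y hy hy' using this
    have hcomm : keepD ℳ m k ∘ₗ Finsupp.linearCombination _ y = r ∘ₗ stdD K n ℳ k := by
      refine Finsupp.lhom_ext' fun b => LinearMap.ext_ring ?_
      rw [LinearMap.comp_apply, LinearMap.comp_apply, Finsupp.lsingle_apply,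
        Finsupp.linearCombination_single, one_smul, hy']
      rfl
    refine ⟨⟨Finsupp.linearCombination _ y, ?_, ?_⟩, hcomm⟩
    · refine Finsupp.lhom_ext' fun b => LinearMap.ext_ring ?_
      simp only [LinearMap.comp_apply, Finsupp.lsingle_apply, keepIncl_single,
        Finsupp.linearCombination_single, one_smul, LinearMap.id_apply]
      exact hy b.1 b.2
    · intro x hx
      rw [← ker_keepD, LinearMap.mem_ker]
      refine (LinearMap.congr_fun hcomm x).trans ?_
      rw [LinearMap.comp_apply, show stdD K n ℳ k x = 0 from hx, map_zero]
  obtain ⟨r₀, hr₀, hr₀'⟩ := h0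
  choose next hnext using hstep
  let seq : ∀ k, Good k := fun k => Nat.rec ⟨r₀, hr₀, fun x hx => by
    rw [keepCycles_zero, LinearMap.mem_ker]
    exact (LinearMap.congr_fun hr₀' x).trans hx⟩ next k
  exact ⟨fun k => (seq k).1, fun k => (seq k).2.1, fun k => hnext k (seq k)⟩

end

/-! ### Tensor products of free modules with a graded module -/

section

variable {N : Type w} [AddCommGroup N] [Module (MvPolynomial (Fin n) K) N]

variable (K n N) in
/-- `R^(ι) ⊗ N = N^(ι)` -/
def freeTensorEquiv (ι : Type v) :
    (ι →₀ MvPolynomial (Fin n) K) ⊗[MvPolynomial (Fin n) K] N ≃ₗ[MvPolynomial (Fin n) K] (ι →₀ N) :=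
  haveI := Classical.decEq ι
  TensorProduct.finsuppScalarLeft (MvPolynomial (Fin n) K) N ι

theorem freeTensorEquiv_tmul_apply {ι : Type v} (x : ι →₀ MvPolynomial (Fin n) K) (y : N)
    (b : ι) : freeTensorEquiv K n N ι (x ⊗ₜ y) b = x b • y := by
  classical
  exact TensorProduct.finsuppScalarLeft_apply_tmul_apply x y b

theorem freeTensorEquiv_symm_single {ι : Type v} (b : ι) (y : N) :
    (freeTensorEquiv K n N ι).symm (Finsupp.single b y) = Finsupp.single b 1 ⊗ₜ y := by
  classical
  exact TensorProduct.finsuppScalarLeft_symm_apply_single b y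

/-- Each coordinate of `x` is homogeneous of degree `c - deg b`, or zero when this number is
negative, so it passes through the projection of `N`. -/
theorem freeTensorEquiv_graded (Q : DegProj K n N) {ι : Type v} (deg : ι → ℤ) {c : ℤ}
    {x : ι →₀ MvPolynomial (Fin n) K} (hx : ((polyProj K n).finsupp deg).p c x = x) (d : ℤ)
    (y : N) :
    (Q.finsupp deg).p (c + d)
        (freeTensorEquiv K n N ι (x ⊗ₜ y)) =
      freeTensorEquiv K n N ι (x ⊗ₜ Q.p d y) := by
  ext b
  rw [DegProj.finsupp_apply, freeTensorEquiv_tmul_apply,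
    freeTensorEquiv_tmul_apply]
  have hb : (polyProj K n).p (c - deg b) (x b) = x b := by
    rw [← DegProj.finsupp_apply, hx]
  rcases lt_or_ge (c - deg b) 0 with h | h
  · rw [polyProj_p_of_neg h] at hb
    rw [← hb, zero_smul, zero_smul, map_zero]
  · obtain ⟨k, hk⟩ := Int.eq_ofNat_of_zero_le h
    rw [hk] at hb
    rw [show c + d - deg b = k + d by omega]
    exact Q.smul k d _ _ (isHomogeneous_iff_polyProj.mpr hb)

/-- A matrix of polynomials acts on the direct sums of copies of `N`. -/
def tensorMap (N : Type w) [AddCommGroup N] [Module (MvPolynomial (Fin n) K) N] {ι κ : Type v}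
    (φ : (ι →₀ MvPolynomial (Fin n) K) →ₗ[MvPolynomial (Fin n) K]
      (κ →₀ MvPolynomial (Fin n) K)) :
    (ι →₀ N) →ₗ[MvPolynomial (Fin n) K] (κ →₀ N) :=
  (freeTensorEquiv K n N κ).toLinearMap ∘ₗ
    φ.rTensor N ∘ₗ (freeTensorEquiv K n N ι).symm.toLinearMap

theorem tensorMap_single {ι κ : Type v}
    (φ : (ι →₀ MvPolynomial (Fin n) K) →ₗ[MvPolynomial (Fin n) K]
      (κ →₀ MvPolynomial (Fin n) K)) (b : ι) (y : N) :
    tensorMap N φ (Finsupp.single b y) =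
      freeTensorEquiv K n N κ
        (φ (Finsupp.single b 1) ⊗ₜ y) := by
  simp [tensorMap, freeTensorEquiv_symm_single]

theorem tensorMap_graded (Q : DegProj K n N) {ι κ : Type v} {deg : ι → ℤ} {deg' : κ → ℤ}
    {φ : (ι →₀ MvPolynomial (Fin n) K) →ₗ[MvPolynomial (Fin n) K]
      (κ →₀ MvPolynomial (Fin n) K)}
    (hφ : ∀ e x, ((polyProj K n).finsupp deg').p e (φ x) =
      φ (((polyProj K n).finsupp deg).p e x)) (e : ℤ) (x : ι →₀ N) :
    (Q.finsupp deg').p e (tensorMap N φ x) = tensorMap N φ ((Q.finsupp deg).p e x) := by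
  induction x using Finsupp.induction_linear with
  | zero => simp
  | add f g hf hg => simp only [map_add, hf, hg]
  | single b y =>
    have h := freeTensorEquiv_graded Q deg' (c := deg b) (x := φ (Finsupp.single b 1))
      (by rw [hφ, finsupp_p_single_one]) (e - deg b) y
    rw [add_sub_cancel] at h
    rw [tensorMap_single, h, DegProj.finsupp_single, tensorMap_single]

theorem freeTensorEquiv_symm_mem_tensorGrading {Q : DegProj K n N} {𝒩 : ℤ → AddSubgroup N}
    (hQ : ∀ d y, Q.p d y ∈ 𝒩 d) {ι : Type v} (deg : ι → ℤ) (e : ℤ) (x : ι →₀ N) :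
    (freeTensorEquiv K n N ι).symm
      ((Q.finsupp deg).p e x) ∈ tensorGrading K n (freeGrading K n deg) 𝒩 e := by
  induction x using Finsupp.induction_linear with
  | zero => simp only [map_zero]; exact zero_mem _
  | add f g hf hg => simp only [map_add]; exact add_mem hf hg
  | single b y =>
    rw [DegProj.finsupp_single, freeTensorEquiv_symm_single]
    exact AddSubgroup.subset_closure ⟨deg b, e - deg b, _, _,
      (mem_freeGrading_iff _ _ _).mpr (finsupp_p_single_one deg b), hQ _ _, by ring, rfl⟩

theorem rTensor_mem_tensorGrading {A : Type*} {B : Type*} [AddCommGroup A]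
    [Module (MvPolynomial (Fin n) K) A] [AddCommGroup B] [Module (MvPolynomial (Fin n) K) B]
    {𝒜 : ℤ → AddSubgroup A} {ℬ : ℤ → AddSubgroup B} {𝒩 : ℤ → AddSubgroup N}
    (f : A →ₗ[MvPolynomial (Fin n) K] B) (hf : ∀ d, ∀ x ∈ 𝒜 d, f x ∈ ℬ d) {e : ℤ}
    {z : A ⊗[MvPolynomial (Fin n) K] N} (hz : z ∈ tensorGrading K n 𝒜 𝒩 e) :
    f.rTensor N z ∈ tensorGrading K n ℬ 𝒩 e := by
  induction hz using AddSubgroup.closure_induction with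
  | mem z hz =>
    obtain ⟨c, d, x, y, hx, hy, hcd, rfl⟩ := hz
    exact AddSubgroup.subset_closure ⟨c, d, f x, y, hf c x hx, hy, hcd, rfl⟩
  | zero => rw [map_zero]; exact zero_mem _
  | add a b _ _ ha hb => rw [map_add]; exact add_mem ha hb
  | neg a _ ha => rw [map_neg]; exact neg_mem ha

end

/-! ### Functoriality of subquotients -/

section

variable {R : Type*} [CommRing R] {C C' : Type*} [AddCommGroup C] [Module R C] [AddCommGroup C']
  [Module R C'] {Z B : Submodule R C} {Z' B' : Submodule R C'}

/-- The map of subquotients induced by a linear map. -/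
def subquotientMap (f : C →ₗ[R] C') (hZ : ∀ x ∈ Z, f x ∈ Z') (hB : ∀ x ∈ B, f x ∈ B') :
    Subquotient R C Z B →ₗ[R] Subquotient R C' Z' B' :=
  Submodule.mapQ _ _ (f.restrict hZ) fun x hx => hB x.1 hx

end

/-! ### The tensor product of a regular module with a graded module -/

section

variable {M : Type v} [AddCommGroup M] [Module (MvPolynomial (Fin n) K) M]
  {N : Type w} [AddCommGroup N] [Module (MvPolynomial (Fin n) K) N]
  {ℳ : ℤ → AddSubgroup M} {𝒩 : ℤ → AddSubgroup N} {m : ℤ}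

/-- The inclusion `α` of the bounded complex and its retraction `β` are chain maps after tensoring
with `N`. They exhibit the homology of the small complex as a retract of `Tor`; only `α` has to
respect degrees. -/
theorem vanishes_of_torGrading {Q : DegProj K n N} (hQ : ∀ d y, Q.p d y ∈ 𝒩 d)
    {r : ∀ k, StdFree K n ℳ k →ₗ[MvPolynomial (Fin n) K] KeepFree K n ℳ m k}
    (hr : ∀ k, r k ∘ₗ keepIncl ℳ m k = LinearMap.id)
    (hrD : ∀ k, keepD ℳ m k ∘ₗ r (k + 1) = r k ∘ₗ stdD K n ℳ k) (i : ℕ) {j : ℕ} {e : ℤ}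
    (h : localCohomologyGrading K n (torGrading K n ℳ 𝒩 (i + 1)) j e = ⊥) :
    ((Q.finsupp (keepDeg ℳ m (i + 1))).subquotient (LinearMap.ker (tensorMap N (keepD ℳ m i)))
      (LinearMap.range (tensorMap N (keepD ℳ m (i + 1))))
      (DegProj.p_mem_ker (tensorMap_graded Q (keepD_graded ℳ m i)))
      (DegProj.p_mem_range (tensorMap_graded Q (keepD_graded ℳ m (i + 1))))).Vanishes j e := by
  let E := fun k => freeTensorEquiv K n N (keep K n ℳ m k)
  let α : ∀ k, (keep K n ℳ m k →₀ N) →ₗ[MvPolynomial (Fin n) K]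
      StdFree K n ℳ k ⊗[MvPolynomial (Fin n) K] N :=
    fun k => (keepIncl ℳ m k).rTensor N ∘ₗ (E k).symm.toLinearMap
  let β : ∀ k, StdFree K n ℳ k ⊗[MvPolynomial (Fin n) K] N →ₗ[MvPolynomial (Fin n) K]
      (keep K n ℳ m k →₀ N) :=
    fun k => (E k).toLinearMap ∘ₗ (r k).rTensor N
  have hβα : ∀ k x, β k (α k x) = x := by
    intro k x
    simp only [α, β, LinearMap.comp_apply, LinearEquiv.coe_coe]
    rw [← LinearMap.rTensor_comp_apply, hr, LinearMap.rTensor_id, LinearMap.id_apply,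
      LinearEquiv.apply_symm_apply]
  have hα : ∀ k x, (stdD K n ℳ k).rTensor N (α (k + 1) x) =
      α k (tensorMap N (keepD ℳ m k) x) := by
    intro k x
    simp only [α, tensorMap, LinearMap.comp_apply, LinearEquiv.coe_coe]
    rw [LinearEquiv.symm_apply_apply, ← LinearMap.rTensor_comp_apply,
      ← LinearMap.rTensor_comp_apply]
    congr 2
    exact LinearMap.ext fun y => (keepIncl_keepD ℳ m k y).symm
  have hβ : ∀ k x, tensorMap N (keepD ℳ m k) (β (k + 1) x) =
      β k ((stdD K n ℳ k).rTensor N x) := by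
    intro k x
    simp only [β, tensorMap, LinearMap.comp_apply, LinearEquiv.coe_coe]
    rw [LinearEquiv.symm_apply_apply, ← LinearMap.rTensor_comp_apply,
      ← LinearMap.rTensor_comp_apply, hrD]
  have hαZ : ∀ x ∈ LinearMap.ker (tensorMap N (keepD ℳ m i)), α (i + 1) x ∈
      torZ K n ℳ N (i + 1) := by
    intro x hx
    rw [LinearMap.mem_ker] at hx
    change (stdD K n ℳ i).rTensor N _ = 0
    rw [hα, hx, map_zero]
  have hαB : ∀ x ∈ LinearMap.range (tensorMap N (keepD ℳ m (i + 1))), α (i + 1) x ∈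
      torB K n ℳ N (i + 1) := by
    rintro _ ⟨x, rfl⟩
    exact ⟨α (i + 2) x, hα (i + 1) x⟩
  have hβZ : ∀ x ∈ torZ K n ℳ N (i + 1), β (i + 1) x ∈
      LinearMap.ker (tensorMap N (keepD ℳ m i)) := by
    intro x hx
    rw [LinearMap.mem_ker, hβ, show (stdD K n ℳ i).rTensor N x = 0 from hx, map_zero]
  have hβB : ∀ x ∈ torB K n ℳ N (i + 1), β (i + 1) x ∈
      LinearMap.range (tensorMap N (keepD ℳ m (i + 1))) := by
    rintro _ ⟨x, rfl⟩
    exact ⟨β (i + 2) x, hβ (i + 1) x⟩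
  refine vanishes_of_retract (subquotientMap (α (i + 1)) hαZ hαB)
    (subquotientMap (β (i + 1)) hβZ hβB) ?_ ?_ h
  · refine LinearMap.ext fun x => ?_
    obtain ⟨x, rfl⟩ := Submodule.mkQ_surjective _ x
    exact congrArg (Submodule.mkQ _) (Subtype.ext (hβα (i + 1) x.1))
  · intro d x
    obtain ⟨x, rfl⟩ := Submodule.mkQ_surjective _ x
    refine ⟨⟨α (i + 1) ((Q.finsupp (keepDeg ℳ m (i + 1))).p d x.1), hαZ _ (DegProj.p_mem_ker
      (tensorMap_graded Q (keepD_graded ℳ m i)) d x.1 x.2)⟩, ?_, rfl⟩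
    refine rTensor_mem_tensorGrading (keepIncl ℳ m (i + 1)) (fun d x hx => ?_)
      (freeTensorEquiv_symm_mem_tensorGrading hQ (keepDeg ℳ m (i + 1)) d x.1)
    rw [mem_freeGrading_iff] at hx ⊢
    exact (keepIncl_graded ℳ m (i + 1) d x).trans (congrArg _ hx)

/-- Generators in step `i` have degree at most `m + i`, so only degrees `d ≥ e - m - i` of the local
cohomology of `N` enter. Right exactness of the tensor product identifies the cokernel of the
tensored complex with `M ⊗ N`. -/
theorem localCohomologyGrading_tensorGrading_eq_bot {P : DegProj K n M} {Q : DegProj K n N}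
    (hPT : P.Total) (hPmem : ∀ d x, P.p d x ∈ ℳ d) (hP : ∀ d, ∀ x ∈ ℳ d, P.p d x = x)
    (hQmem : ∀ d y, Q.p d y ∈ 𝒩 d) (hQ : ∀ d, ∀ y ∈ 𝒩 d, Q.p d y = y) (hreg : P.Regular m)
    {j : ℕ} {e : ℤ} (hN : ∀ i : ℕ, ∀ d : ℤ, e - m - i ≤ d → Q.Vanishes (j + i) d)
    (hTor : ∀ i : ℕ, localCohomologyGrading K n (torGrading K n ℳ 𝒩 (i + 1)) (j + i + 2) e = ⊥) :
    localCohomologyGrading K n (tensorGrading K n ℳ 𝒩) j e = ⊥ := by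
  obtain ⟨r, hr, hrD⟩ := exists_keep_retraction (K := K) hP hPT hPmem hreg
  have hrange : ∀ k, LinearMap.range (keepD (K := K) (n := n) ℳ m k) = keepCycles ℳ m k :=
    fun k => range_keepD_of_regular hP (keepCycles_regular hP hPT hPmem hreg k)
  have key := DegProj.vanishes_coker_of_complex (C := fun i => keep K n ℳ m i →₀ N)
    (fun i => Q.finsupp (keepDeg ℳ m i)) (fun i => tensorMap N (keepD ℳ m i))
    (fun i => tensorMap_graded Q (keepD_graded ℳ m i)) (fun i x => by
      simp only [tensorMap, LinearMap.comp_apply, LinearEquiv.coe_coe,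
        LinearEquiv.symm_apply_apply]
      rw [← LinearMap.rTensor_comp_apply, show keepD ℳ m i ∘ₗ keepD ℳ m (i + 1) = 0 from
        LinearMap.ext fun y => ?_, LinearMap.rTensor_zero, LinearMap.zero_apply, map_zero]
      have h := keepD_mem_keepCycles ℳ m (i + 1) y
      rw [← ker_keepD] at h
      exact h) j e
    (fun i => DegProj.Vanishes.finsupp fun b => hN i _ (by
      have := keepDeg_le (K := K) (n := n) ℳ m i b
      omega))
    (fun i => vanishes_of_torGrading hQmem hr hrD i (hTor i))
  let ε := stdAug K n ℳ ∘ₗ keepIncl ℳ m 0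
  have hε : Function.Surjective ε := keepAug_surjective hPT hPmem hreg
  let E := freeTensorEquiv K n N (keep K n ℳ m 0)
  let π : (keep K n ℳ m 0 →₀ N) →ₗ[MvPolynomial (Fin n) K] M ⊗[MvPolynomial (Fin n) K] N :=
    ε.rTensor N ∘ₗ E.symm.toLinearMap
  have hπ : Function.Surjective π := (LinearMap.rTensor_surjective N hε).comp E.symm.surjective
  have hexact : Function.Exact (keepD (K := K) (n := n) ℳ m 0) ε := by
    rw [LinearMap.exact_iff, hrange, keepCycles_zero]
  have hker : LinearMap.ker π = LinearMap.range (tensorMap N (keepD ℳ m 0)) := by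
    have h := (LinearMap.exact_iff.mp (rTensor_exact N hexact hε))
    ext x
    rw [LinearMap.mem_ker, LinearMap.comp_apply, ← LinearMap.mem_ker, h]
    constructor
    · rintro ⟨y, hy⟩
      refine ⟨freeTensorEquiv K n N _ y, ?_⟩
      simp only [tensorMap, LinearMap.comp_apply, LinearEquiv.coe_coe,
        LinearEquiv.symm_apply_apply]
      rw [hy]
      exact E.apply_symm_apply x
    · rintro ⟨y, rfl⟩
      exact ⟨(freeTensorEquiv K n N _).symm y,
        (E.symm_apply_apply _).symm⟩
  let Θ := (Submodule.quotEquivOfEq _ _ hker.symm).trans (π.quotKerEquivOfSurjective hπ)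
  have hΘ : ∀ x, Θ.symm (π x) = (LinearMap.range (tensorMap N (keepD ℳ m 0))).mkQ x := by
    intro x
    rw [LinearEquiv.symm_apply_eq]
    rfl
  refine key.localCohomologyGrading_eq_bot Θ.symm.toLinearMap Θ.toLinearMap
    (LinearMap.ext fun x => Θ.apply_symm_apply x) fun d z hz => ?_
  induction hz using AddSubgroup.closure_induction with
  | mem z hz =>
    obtain ⟨c, d', x, y, hx, hy, rfl, rfl⟩ := hz
    obtain ⟨q, hq⟩ := hε x
    -- The lift of a homogeneous element can be made homogeneous of the same degree by projecting
    -- it.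
    have hq' : ε ((keepProj ℳ m 0).p c q) = x := by
      rw [← hP c x hx, ← hq]
      exact (keepAug_graded hP c q).symm
    have hxy : x ⊗ₜ y = π (E ((keepProj ℳ m 0).p c q ⊗ₜ y)) := by
      simp only [π, LinearMap.comp_apply, LinearEquiv.coe_coe, LinearEquiv.symm_apply_apply]
      rw [LinearMap.rTensor_tmul, hq']
    rw [hxy, LinearEquiv.coe_coe, hΘ, DegProj.quotient_mkQ]
    congr 1
    have h := freeTensorEquiv_graded Q (keepDeg ℳ m 0) ((keepProj ℳ m 0).idem c q) d' y
    rw [hQ d' y hy] at h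
    exact h
  | zero => rw [map_zero, map_zero]
  | add a b _ _ ha hb => rw [map_add, map_add, ha, hb]
  | neg a _ ha => rw [map_neg, map_neg, ha]

/-- The upper bound `n` on the indices can be dropped, since the Čech complex is zero beyond it. The
chase needs this, as it reaches all `H^{j+i}(N)`. -/
theorem IsRegularWrt.vanishes {P : DegProj K n M} (hPmem : ∀ d x, P.p d x ∈ ℳ d) {a : ℕ}
    (h : IsRegularWrt K n ℳ m (Set.Icc a n)) {j : ℕ} (hj : a ≤ j) {e : ℤ} (he : m - j < e) :
    P.Vanishes j e := by
  by_cases hjn : j ≤ n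
  · exact vanishes_of_retract LinearMap.id LinearMap.id rfl hPmem (h j ⟨hj, hjn⟩ e he)
  · exact P.vanishes_of_lt (not_le.mp hjn) e

end

end

end GradedReg

/-! ### Regularity of the tensor product -/

theorem theorem3p3 {K : Type u} [Field K] {n : ℕ}
    {M : Type v} [AddCommGroup M] [Module (MvPolynomial (Fin n) K) M]
    [Module.Finite (MvPolynomial (Fin n) K) M]
    {N : Type w} [AddCommGroup N] [Module (MvPolynomial (Fin n) K) N]
    [Module.Finite (MvPolynomial (Fin n) K) N]
    (ℳ : ℤ → AddSubgroup M) (𝒩 : ℤ → AddSubgroup N)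
    (hM : GradedReg.IsGrading K n ℳ)
    (hN : GradedReg.IsGrading K n 𝒩)
    (a : ℕ) (m s : ℤ)
    (hMreg : GradedReg.IsRegularWrt K n ℳ m (Set.Icc 0 n))
    (hNreg : GradedReg.IsRegularWrt K n 𝒩 s (Set.Icc a n))
    (hTor : ∀ i : ℕ, 0 < i →
      GradedReg.IsRegularWrt K n (GradedReg.torGrading K n ℳ 𝒩 i)
        (m + s + i + 1) ((fun j => j + i + 1) '' Set.Icc a n)) :
    GradedReg.IsRegularWrt K n (GradedReg.tensorGrading K n ℳ 𝒩)
      (m + s) (Set.Icc a n) := by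
  obtain ⟨P, hPT, hPmem, hP⟩ := GradedReg.exists_degProj_of_isGrading hM
  obtain ⟨Q, -, hQmem, hQ⟩ := GradedReg.exists_degProj_of_isGrading hN
  intro j hj e he
  refine GradedReg.localCohomologyGrading_tensorGrading_eq_bot hPT hPmem hP hQmem hQ
    (fun j e he => hMreg.vanishes hPmem (Nat.zero_le j) he)
    (fun i d hd => hNreg.vanishes hQmem (hj.1.trans (Nat.le_add_right j i)) ?_)
    -- For `Tor_{i+1}` the bound is `m + s + (i + 1) + 1 - (j + i + 2) = m + s - j`, exactly the one
    -- assumed for `e`.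
    (fun i => hTor (i + 1) i.succ_pos (j + i + 2) ⟨j, hj, rfl⟩ e ?_)
  · push_cast
    omega
  · push_cast
    omega
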